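/- For $\Re(w)>0$ and $a\in(0,\infty)^2$ let $\zeta_2(s,w\,|\,a)$ be the analytic continuation to $s\in\mathbb{C}\setminus\{1,2\}$ of $\sum_{k_1,k_2\ge 0}(w+k_1a_1+k_2a_2)^{-s}$ $(\Re s>2)$, and let $\Gamma_2(w\,|\,a)=\exp\bigl(\partial_s\zeta_2(s,w\,|\,a)|_{s=0}\bigr)$ be the Barnes double gamma function. For $\delta>0$ let $\beta_{2,2}(\delta)$ denote the Barnes beta distribution with parameters $a=(1,1)$, $b_0=\delta$, $b_1=b_2=1/2$, i.e. the probability distribution on $(0,1]$ with Mellin transform, writing $\Gamma_2(w)=\Gamma_2(w\,|\,(1,1))$, $$\mathbf{E}\bigl[\beta_{2,2}^q(\delta)\bigr]=\frac{\Gamma_2(q+\delta)}{\Gamma_2(\delta)}\,\frac{\Gamma_2(\delta+\tfrac12)^2}{\Gamma_2(q+\delta+\tfrac12)^2}\,\frac{\Gamma_2(q+\delta+1)}{\Gamma_2(\delta+1)},\qquad \Re(q)>-\delta.$$ Let $$\kappa_n(\delta)=(-1)^n\frac{d^n}{dq^n}\Big|_{q=0}\log\mathbf{E}\bigl[\beta_{2,2}^q(\delta)\bigr]$$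 be the $n$th cumulant of $-\log\beta_{2,2}(\delta)$. Let $C_2$ be the probability distribution on $(0,\infty)$ with Laplace transform $\mathbf{E}[e^{-qC_2}]=(1/\cosh\sqrt{2q})^2$, $q>0$, and let $\xi$ be the entire function $\xi(q)=\frac12 q(q-1)\pi^{-q/2}\Gamma(q/2)\zeta(q)$ (so $\xi(0)=\xi(1)=\frac12$). **Theorem.** For $0<\delta<1$ and $n=1,2,3,\dots$, the function $q\mapsto\log\mathbf{E}[\beta_{2,2}^q(\delta)]$ is $n$ times continuously differentiable near $q=0$, the moments $\mathbf{E}[C_2^{-(m+n)/2}]$, $m\ge 0$, are finite, the following series converges (absolutely), and $$\kappa_n(\delta)=\frac18\sum_{m=0}^\infty\frac{\bigl(-(\delta-\frac12)\bigr)^m}{m!}\,32^{(m+n)/2}\,\Gamma\Bigl(\frac{m+n}{2}\Bigr)\,\mathbf{E}\bigl[C_2^{-(m+n)/2}\bigr]$$ (with $0^0=1$). In particular, for $\delta=1/2$ and $n=1,2,3,\dots$, $$\kappa_n(1/2)=\frac{32^{n/2}}{8}\,\Gamma\Bigl(\frac n2\Bigr)\,\frac{2^{2-n}-1}{1-n/2}\,\Bigl(\frac2\pi\Bigr)^{1-n/2}\xi(n-1),$$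 where for $n=2$ the quotient $(2^{2-n}-1)/(1-n/2)$ is read as its limit value $2\log 2$. -/

import Mathlib

open MeasureTheory Filter Topology

noncomputable section

/-! ### Barnes multiple zeta and log-gamma functions -/

/-- The complex plane without the possible poles `1, …, M` of the Barnes zeta function. -/
def barnesDomain (M : ℕ) : Set ℂ := {s | ∀ m : ℕ, 1 ≤ m → m ≤ M → s ≠ (m : ℂ)}

/-- The Barnes multiple series `∑_{k₁,…,k_M ≥ 0} (w + k₁ a₁ + ⋯ + k_M a_M)^{-s}`
(absolutely convergent for `Re s > M`, `Re w > 0`, `aᵢ > 0`). -/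
def barnesSeries {M : ℕ} (a : Fin M → ℝ) (s w : ℂ) : ℂ :=
  ∑' k : Fin M → ℕ, (w + ∑ i, (k i : ℂ) * (a i : ℂ)) ^ (-s)

/-- `Z` is an analytic continuation in `s` of the Barnes series at `w` to `ℂ ∖ {1, …, M}`. -/
def IsBarnesZeta {M : ℕ} (a : Fin M → ℝ) (w : ℂ) (Z : ℂ → ℂ) : Prop :=
  DifferentiableOn ℂ Z (barnesDomain M) ∧
    ∀ s : ℂ, (M : ℝ) < s.re → Z s = barnesSeries a s w

/-- The analytic continuation is unique on `ℂ ∖ {1, …, M}`. -/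
theorem IsBarnesZeta.eqOn {M : ℕ} {a : Fin M → ℝ} {w : ℂ} {Z Z' : ℂ → ℂ}
    (h : IsBarnesZeta a w Z) (h' : IsBarnesZeta a w Z') :
    Set.EqOn Z Z' (barnesDomain M) := by
  have hfin : (((fun m : ℕ => (m : ℂ)) '' Set.Icc 1 M)).Finite :=
    (Set.finite_Icc 1 M).image _
  have hdom : barnesDomain M = ((fun m : ℕ => (m : ℂ)) '' Set.Icc 1 M)ᶜ := by
    ext s
    simp only [barnesDomain, Set.mem_ofPred_eq, Set.mem_compl_iff, Set.mem_image, Set.mem_Icc]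
    constructor
    · rintro hs ⟨m, ⟨h1, h2⟩, rfl⟩
      exact hs m h1 h2 rfl
    · rintro hs m h1 h2 rfl
      exact hs ⟨m, ⟨h1, h2⟩, rfl⟩
  have hopen : IsOpen (barnesDomain M) := by
    rw [hdom]; exact hfin.isClosed.isOpen_compl
  have hconn : IsPreconnected (barnesDomain M) := by
    rw [hdom]
    exact (hfin.countable.isConnected_compl_of_one_lt_rank
      (by rw [Complex.rank_real_complex]; norm_num)).isPreconnected
  have hz : ((M : ℂ) + 1) ∈ barnesDomain M := by
    intro m _ h2 he
    have h3 : M + 1 = m := by exact_mod_cast he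
    omega
  refine (h.1.analyticOnNhd hopen).eqOn_of_preconnected_of_eventuallyEq
    (h'.1.analyticOnNhd hopen) hconn hz ?_
  have hU : {s : ℂ | (M : ℝ) < s.re} ∈ 𝓝 ((M : ℂ) + 1) :=
    (isOpen_lt continuous_const Complex.continuous_re).mem_nhds (by simp)
  filter_upwards [hU] with s hs
  rw [h.2 s hs, h'.2 s hs]

open Classical in
/-- The Barnes multiple zeta function `ζ_M(s, w | a)`, as the analytic continuation of the Barnes
series in `s`. -/
def barnesZeta {M : ℕ} (a : Fin M → ℝ) (s w : ℂ) : ℂ :=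
  if h : ∃ Z : ℂ → ℂ, IsBarnesZeta a w Z then h.choose s else 0

/-- The Barnes multiple log-gamma function `L_M(w | a) = ∂_s ζ_M(s, w | a)|_{s = 0}`. -/
def barnesLogGamma {M : ℕ} (a : Fin M → ℝ) (w : ℂ) : ℂ :=
  deriv (fun s => barnesZeta a s w) 0

/-! ### Barnes beta distributions -/

/-- The operator `(𝒮_N h)(q | b) = ∑_p (-1)^p ∑_{k₁<⋯<k_p} h(q + b₀ + b_{k₁} + ⋯ + b_{k_p})`. -/
def barnesS {N : ℕ} (b₀ : ℝ) (b : Fin N → ℝ) (h : ℂ → ℂ) (q : ℂ) : ℂ :=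
  ∑ J : Finset (Fin N), (-1 : ℂ) ^ J.card * h (q + (b₀ : ℂ) + ∑ j ∈ J, (b j : ℂ))

/-- `η_{M,N}(q | a, b) = exp((𝒮_N L_M)(q | a, b) - (𝒮_N L_M)(0 | a, b))`. -/
def barnesEta {M N : ℕ} (a : Fin M → ℝ) (b₀ : ℝ) (b : Fin N → ℝ) (q : ℂ) : ℂ :=
  Complex.exp (barnesS b₀ b (barnesLogGamma a) q - barnesS b₀ b (barnesLogGamma a) 0)

/-- `μ` is a probability law on `(0, 1]` with Mellin transform `η_{M,N}(q | a, b)`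
for `Re q > -b₀`. -/
structure IsBarnesBeta {M N : ℕ} (a : Fin M → ℝ) (b₀ : ℝ) (b : Fin N → ℝ)
    (μ : Measure ℝ) : Prop where
  isProbabilityMeasure : IsProbabilityMeasure μ
  support : μ (Set.Ioc 0 1)ᶜ = 0
  integrable : ∀ q : ℂ, -b₀ < q.re → Integrable (fun x : ℝ => (x : ℂ) ^ q) μ
  mellin : ∀ q : ℂ, -b₀ < q.re → ∫ x : ℝ, (x : ℂ) ^ q ∂μ = barnesEta a b₀ b q

/-- A law on `(0, 1]` is determined by its Mellin transform. -/
theorem IsBarnesBeta.unique {M N : ℕ} {a : Fin M → ℝ} {b₀ : ℝ} {b : Fin N → ℝ}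
    (hb₀ : 0 < b₀) {μ ν : Measure ℝ} (hμ : IsBarnesBeta a b₀ b μ)
    (hν : IsBarnesBeta a b₀ b ν) : μ = ν := by
  have key : ∀ ρ : Measure ℝ, IsBarnesBeta a b₀ b ρ →
      (∀ t : ℝ, charFun (ρ.map Real.log) t = barnesEta a b₀ b (t * Complex.I)) ∧
        (ρ.map Real.log).map Real.exp = ρ := by
    intro ρ hρ
    have hae : ∀ᵐ x ∂ρ, x ∈ Set.Ioc (0 : ℝ) 1 := hρ.support
    constructor
    · intro t
      rw [charFun_apply_real, integral_map Real.measurable_log.aemeasurable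
        (by fun_prop), ← hρ.mellin _ (by simpa using hb₀)]
      refine integral_congr_ae ?_
      filter_upwards [hae] with x hx
      rw [Complex.cpow_def_of_ne_zero (by exact_mod_cast hx.1.ne'), Complex.ofReal_log hx.1.le]
      ring_nf
    · rw [Measure.map_map Real.measurable_exp Real.measurable_log]
      conv_rhs => rw [← Measure.map_id (μ := ρ)]
      refine Measure.map_congr ?_
      filter_upwards [hae] with x hx
      simp [Real.exp_log hx.1]
  have := hμ.isProbabilityMeasure
  have := hν.isProbabilityMeasure
  have h1 : μ.map Real.log = ν.map Real.log := by
    refine Measure.ext_of_charFun (funext fun t => ?_)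
    rw [(key μ hμ).1, (key ν hν).1]
  rw [← (key μ hμ).2, ← (key ν hν).2, h1]

open Classical in
/-- The Barnes beta distribution `β_{M,N}(a, b)`: the law on `(0, 1]` with Mellin transform
`η_{M,N}(· | a, b)`. -/
def barnesBeta {M N : ℕ} (a : Fin M → ℝ) (b₀ : ℝ) (b : Fin N → ℝ) : Measure ℝ :=
  if h : ∃ μ : Measure ℝ, IsBarnesBeta a b₀ b μ then h.choose else 0

/-- `β_{2,2}(δ) = β_{2,2}(a = (1,1), b₀ = δ, b₁ = b₂ = 1/2)`. -/
def beta22 (δ : ℝ) : Measure ℝ := barnesBeta ![1, 1] δ ![1 / 2, 1 / 2]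

/-- The logarithm of the Mellin transform, `q ↦ log E[β_{2,2}(δ)^q]`, for real `q`. -/
def logMellinBeta22 (δ q : ℝ) : ℝ := Real.log (∫ x : ℝ, x ^ q ∂(beta22 δ))

/-- The `n`-th cumulant of `-log β_{2,2}(δ)`. -/
def cumulantBeta22 (n : ℕ) (δ : ℝ) : ℝ := (-1) ^ n * iteratedDeriv n (logMellinBeta22 δ) 0

/-! ### The `C₂` distribution -/

/-- `μ` is a probability law on `(0, ∞)` with Laplace transform `(1 / cosh √(2q))²`, `q > 0`. -/
structure IsC2 (μ : Measure ℝ) : Prop where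
  isProbabilityMeasure : IsProbabilityMeasure μ
  support : μ (Set.Ioi 0)ᶜ = 0
  laplace : ∀ q : ℝ, 0 < q →
    ∫ x : ℝ, Real.exp (-q * x) ∂μ = (1 / Real.cosh (Real.sqrt (2 * q))) ^ 2

open Classical in
/-- The `C₂` distribution: the law on `(0, ∞)` with Laplace transform `(1 / cosh √(2q))²`. -/
def distC2 : Measure ℝ := if h : ∃ μ : Measure ℝ, IsC2 μ then h.choose else 0

/-! ### The Riemann xi function -/

/-- The Riemann xi function `ξ(s) = ½ s (s - 1) π^{-s/2} Γ(s/2) ζ(s)`, as an entire function: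
`completedRiemannZeta₀ s` is `π^{-s/2} Γ(s/2) ζ(s) + 1/s + 1/(1-s)`. The two theorems below show
that this is the entire function which is given by that formula wherever the formula makes sense. -/
def riemannXi (s : ℂ) : ℂ := (s * (s - 1) * completedRiemannZeta₀ s + 1) / 2

theorem differentiable_riemannXi : Differentiable ℂ riemannXi := by
  have := differentiable_completedZeta₀
  unfold riemannXi
  fun_prop

theorem riemannXi_eq {s : ℂ} (h1 : s ≠ 1) (hs : ∀ n : ℕ, s / 2 ≠ -n) :
    riemannXi s = 1 / 2 * s * (s - 1) * (Real.pi : ℂ) ^ (-s / 2) * Complex.Gamma (s / 2) *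
      riemannZeta s := by
  have h0 : s ≠ 0 := by
    intro h; exact hs 0 (by simp [h])
  have hG : Complex.Gammaℝ s ≠ 0 := by
    rw [Complex.Gammaℝ_def]
    refine mul_ne_zero ?_ (Complex.Gamma_ne_zero hs)
    rw [Complex.cpow_def_of_ne_zero (by exact_mod_cast Real.pi_ne_zero)]
    exact Complex.exp_ne_zero _
  have h2 : (1 : ℂ) - s ≠ 0 := sub_ne_zero.mpr (Ne.symm h1)
  have h3 : (Real.pi : ℂ) ^ (-s / 2) * Complex.Gamma (s / 2) * riemannZeta s =
      completedRiemannZeta₀ s - 1 / s - 1 / (1 - s) := by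
    rw [← completedRiemannZeta_eq, ← Complex.Gammaℝ_def, riemannZeta_def_of_ne_zero h0]
    field_simp
  have h4 : riemannXi s = 1 / 2 * s * (s - 1) *
      (completedRiemannZeta₀ s - 1 / s - 1 / (1 - s)) := by
    unfold riemannXi
    field_simp
    ring
  rw [h4, ← h3]
  ring

/-- The function `x ↦ (2^{2-x} - 1) / (1 - x/2)`, with its removable singularity at `x = 2`
filled in by the limit value `2 log 2`. -/
def xiQuotient (x : ℝ) : ℝ :=
  if x = 2 then 2 * Real.log 2 else ((2 : ℝ) ^ (2 - x) - 1) / (1 - x / 2)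

theorem continuousAt_xiQuotient_two : ContinuousAt xiQuotient 2 := by
  have hd : HasDerivAt (fun x : ℝ => (2 : ℝ) ^ (2 - x)) (-Real.log 2) 2 := by
    have h := ((hasDerivAt_id (2 : ℝ)).const_sub 2).const_rpow (a := 2) (by norm_num)
    simpa using h
  have ht := (hasDerivAt_iff_tendsto_slope.mp hd).const_mul (-2)
  rw [continuousAt_iff_punctured_nhds]
  have h2 : xiQuotient 2 = -2 * -Real.log 2 := by simp [xiQuotient]
  rw [h2]
  refine ht.congr' ?_
  filter_upwards [self_mem_nhdsWithin] with x hx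
  have hx' : x ≠ 2 := hx
  have h3 : x - 2 ≠ 0 := sub_ne_zero.mpr hx'
  have h4 : 1 - x / 2 ≠ 0 := by
    intro h; apply h3; linarith
  have h5 : 2 - x ≠ 0 := fun h => h3 (by linarith)
  simp only [xiQuotient, hx', if_false, slope_def_field, sub_self, Real.rpow_zero]
  field_simp
  ring

end

/-! Every cumulant of `-log β₂,₂(δ)` is a moment of one explicit kernel. Put `x = e^{-t/2}`. The
Mellin transform in `s` of `e^{-wt}/(1-e^{-t})²` is `Γ(s) ζ₂(s,w)`, and the signed combination of
the shifts `0, 1/2, 1/2, 1` multiplies the kernel by `(1-x)²`. Since `1-e^{-t} = (1-x)(1+x)`, what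
is left is `k_δ(t) = e^{-δt}/(1+e^{-t/2})²`, which is regular at `t = 0`. Subtracting the value at
`q = 0` lets the Mellin integral reach `s = 0`, where `1/Γ(s)` vanishes to first order, so `log
E[β^q] = ∫₀^∞ (e^{-qt}-1) k_δ(t) dt/t` (`barnesS_barnesLogGamma_sub`). Differentiating `n` times at
`0` gives `κ_n = ∫₀^∞ t^{n-1} k_δ(t) dt` (`contDiffAt_logMellinBeta22`).

Next, `k_δ(t) = e^{-(δ-1/2)t} / (4 cosh²(t/4))`. Expanding the exponential, which is legitimate for
`|δ-1/2| < 1/2`, reduces everything to the moments `∫ u^{p-1}/cosh² u du`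
(`hasSum_betaKernel_moment`). These are also the negative moments of `C₂`: integrate `q^{s-1}`
against its Laplace transform and substitute `u = √(2q)` (`IsC2.negative_moment`).

At `δ = 1/2` a single moment survives. For `n ≥ 3` the expansion of `1/cosh²` in powers of `e^{-2u}`
turns it into an alternating zeta series at `n-1`, and the duplication formula for `Γ` produces
`ξ(n-1)`. The cases `n = 1, 2` are evaluated by explicit antiderivatives.

Because the two laws and `ζ₂` are defined by choice, their existence has to be proved. The
continuation of `ζ₂` comes from subtracting Taylor terms under the Mellin integral
(`exists_entire_barnes`). Both laws come from infinite sums of independent nonnegative variables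
(`exists_law_tsum`): Gamma variables with rates from Euler's product for `C₂`, and variables with
rational Laplace transforms for `-log β₂,₂`. -/

noncomputable section

/-! ### Laws of infinite sums of independent nonnegative variables -/

open ProbabilityTheory in
/-- The law of the sum of independent nonnegative variables whose exponential moments multiply
to a bounded sequence. -/
theorem exists_law_tsum (ν : ℕ → Measure ℝ) [∀ k, IsProbabilityMeasure (ν k)]
    (hν : ∀ k, ν k (Set.Iio 0) = 0) {b : ℝ} (hb : 0 < b)
    (hint : ∀ k r, r < b → Integrable (fun x => Real.exp (r * x)) (ν k))
    (hbdd : ∀ r, 0 ≤ r → r < b →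
      ∃ C, ∀ N, ∏ k ∈ Finset.range N, ∫ x, Real.exp (r * x) ∂(ν k) ≤ C) :
    ∃ μ : Measure ℝ, IsProbabilityMeasure μ ∧ μ (Set.Iio 0) = 0 ∧
      (∀ k, μ (Set.Iic 0) ≤ ν k (Set.Iic 0)) ∧
      ∀ q : ℂ, -b < q.re → Integrable (fun x : ℝ => Complex.exp (-q * x)) μ ∧
        Tendsto (fun N => ∏ k ∈ Finset.range N, ∫ x : ℝ, Complex.exp (-q * x) ∂(ν k)) atTop
          (𝓝 (∫ x : ℝ, Complex.exp (-q * x) ∂μ)) := by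
  set P : Measure (ℕ → ℝ) := Measure.infinitePi ν with hP
  have hind : iIndepFun (fun (k : ℕ) (ω : ℕ → ℝ) => ω k) P :=
    iIndepFun_infinitePi (P := ν) (X := fun _ x => x) (fun _ => measurable_id)
  have hmap : ∀ k, P.map (fun ω => ω k) = ν k := fun k => Measure.infinitePi_map_eval ν k
  have hX : ∀ k, Measurable (fun ω : ℕ → ℝ => ω k) := fun k => measurable_pi_apply k
  have hpos : ∀ᵐ ω ∂P, ∀ k, 0 ≤ ω k := by
    rw [ae_all_iff]
    intro k
    have : ∀ᵐ x ∂(ν k), 0 ≤ x := by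
      rw [ae_iff]; simpa [Set.Iio] using hν k
    rw [← hmap k] at this
    exact ae_of_ae_map (hX k).aemeasurable this
  set S : ℕ → (ℕ → ℝ) → ℝ := fun N ω => ∑ k ∈ Finset.range N, ω k with hS
  have hSm : ∀ N, Measurable (S N) := fun N => by fun_prop
  have hprodC : ∀ (q : ℂ) N, ∫ ω, Complex.exp (-q * S N ω) ∂P =
      ∏ k ∈ Finset.range N, ∫ x : ℝ, Complex.exp (-q * x) ∂(ν k) := by
    intro q N
    have h1 := (hind.precomp (g := fun i : Fin N => (i : ℕ)) Fin.val_injective).integral_fun_prod_comp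
      (f := fun _ (x : ℝ) => Complex.exp (-q * x)) (fun i => (hX _).aemeasurable)
      (fun i => by fun_prop)
    rw [Finset.prod_range]
    convert h1 using 1
    · congr 1; ext ω
      rw [← Complex.exp_sum, ← Finset.mul_sum, hS]
      simp [Finset.sum_range]
    · refine Finset.prod_congr rfl fun i _ => ?_
      rw [← hmap i, integral_map (hX i).aemeasurable (by fun_prop)]
  have hprod : ∀ (r : ℝ) N, ∫ ω, Real.exp (r * S N ω) ∂P =
      ∏ k ∈ Finset.range N, ∫ x : ℝ, Real.exp (r * x) ∂(ν k) := by
    intro r N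
    have := hprodC (-r) N
    have e : ∀ x : ℝ, Complex.exp (-(-r : ℂ) * x) = (Real.exp (r * x) : ℂ) := by
      intro x; push_cast; ring_nf
    simp only [e, integral_complex_ofReal] at this
    exact_mod_cast this
  have hexpint : ∀ (r : ℝ) N, r < b → Integrable (fun ω => Real.exp (r * S N ω)) P := by
    intro r N hr
    have h1 : ∀ k, Integrable (fun ω : ℕ → ℝ => Real.exp (r * ω k)) P := by
      intro k
      have := hint k r hr
      rw [← hmap k] at this
      exact this.comp_measurable (hX k)
    have h2 := hind.integrable_exp_mul_sum hX (s := Finset.range N) (t := r) (fun i _ => h1 i)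
    simpa [hS, Finset.sum_apply] using h2
  have hlint : ∀ r, 0 ≤ r → r < b → ∃ C, ∀ N, ∫⁻ ω, ENNReal.ofReal (Real.exp (r * S N ω)) ∂P ≤
      ENNReal.ofReal C := by
    intro r h0 hr
    obtain ⟨C, hC⟩ := hbdd r h0 hr
    refine ⟨C, fun N => ?_⟩
    rw [← ofReal_integral_eq_lintegral_ofReal (hexpint r N hr)
      (ae_of_all _ fun _ => (Real.exp_pos _).le), hprod]
    exact ENNReal.ofReal_le_ofReal (hC N)
  have hmono : ∀ r, 0 ≤ r → ∀ᵐ ω ∂P, Monotone fun N => ENNReal.ofReal (Real.exp (r * S N ω)) := by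
    intro r h0
    filter_upwards [hpos] with ω hω
    refine monotone_nat_of_le_succ fun N => ENNReal.ofReal_le_ofReal (Real.exp_le_exp.mpr ?_)
    refine mul_le_mul_of_nonneg_left ?_ h0
    simp only [hS, Finset.sum_range_succ]
    linarith [hω N]
  -- By monotone convergence `sup_N exp((b/2) S_N)` is integrable, hence almost surely finite. Then
  -- `1 + x ≤ e^x` bounds the partial sums. Any exponent strictly between `0` and `b` would do.
  have hsum : ∀ᵐ ω ∂P, Summable ω := by
    obtain ⟨C, hC⟩ := hlint (b / 2) (by linarith) (by linarith)
    have hm : ∀ N, AEMeasurable (fun ω => ENNReal.ofReal (Real.exp (b / 2 * S N ω))) P :=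
      fun N => by fun_prop
    have h1 : ∫⁻ ω, ⨆ N, ENNReal.ofReal (Real.exp (b / 2 * S N ω)) ∂P ≤ ENNReal.ofReal C := by
      rw [lintegral_iSup' hm (hmono _ (by linarith))]
      exact iSup_le hC
    have h2 := ae_lt_top' (AEMeasurable.iSup hm) (ne_top_of_le_ne_top ENNReal.ofReal_ne_top h1)
    filter_upwards [h2, hpos] with ω hω h0
    set D := ⨆ N, ENNReal.ofReal (Real.exp (b / 2 * S N ω)) with hD
    refine summable_of_sum_range_le (c := D.toReal * (2 / b)) h0 fun N => ?_
    have h3 : ENNReal.ofReal (Real.exp (b / 2 * S N ω)) ≤ D :=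
      le_iSup (fun N => ENNReal.ofReal (Real.exp (b / 2 * S N ω))) N
    have h4 : Real.exp (b / 2 * S N ω) ≤ D.toReal := by
      rw [← ENNReal.ofReal_le_iff_le_toReal hω.ne]; exact h3
    have h5 := Real.add_one_le_exp (b / 2 * S N ω)
    have h6 : b / 2 * S N ω ≤ D.toReal := by linarith
    calc S N ω = (b / 2 * S N ω) * (2 / b) := by field_simp
      _ ≤ _ := by gcongr
  set T : (ℕ → ℝ) → ℝ := fun ω => ∑' k, ω k with hT
  have hlim : ∀ᵐ ω ∂P, Tendsto (fun N => S N ω) atTop (𝓝 (T ω)) := by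
    filter_upwards [hsum] with ω hω using hω.hasSum.tendsto_sum_nat
  have hTm : AEMeasurable T P :=
    aemeasurable_of_tendsto_metrizable_ae atTop (fun N => (hSm N).aemeasurable) hlim
  have hTint : ∀ r, 0 ≤ r → r < b → Integrable (fun ω => Real.exp (r * T ω)) P := by
    intro r h0 hr
    obtain ⟨C, hC⟩ := hlint r h0 hr
    have h1 : Tendsto (fun N => ∫⁻ ω, ENNReal.ofReal (Real.exp (r * S N ω)) ∂P) atTop
        (𝓝 (∫⁻ ω, ENNReal.ofReal (Real.exp (r * T ω)) ∂P)) := by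
      refine lintegral_tendsto_of_tendsto_of_monotone (fun N => by fun_prop) (hmono r h0) ?_
      filter_upwards [hlim] with ω hω
      exact (ENNReal.continuous_ofReal.tendsto _).comp
        ((Real.continuous_exp.tendsto _).comp (hω.const_mul r))
    have h2 := le_of_tendsto' h1 hC
    refine ⟨(Real.measurable_exp.comp_aemeasurable (hTm.const_mul r)).aestronglyMeasurable, ?_⟩
    rw [hasFiniteIntegral_iff_ofReal (ae_of_all _ fun _ => (Real.exp_pos _).le)]
    exact lt_of_le_of_lt h2 ENNReal.ofReal_lt_top
  have hle : ∀ᵐ ω ∂P, (∀ N, 0 ≤ S N ω ∧ S N ω ≤ T ω) ∧ ∀ k, ω k ≤ T ω := by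
    filter_upwards [hpos, hsum] with ω h0 h1
    exact ⟨fun N => ⟨Finset.sum_nonneg fun k _ => h0 k, h1.sum_le_tsum _ fun k _ => h0 k⟩,
      fun k => h1.le_tsum k fun j _ => h0 j⟩
  have hbound : ∀ q : ℂ, ∀ x y : ℝ, 0 ≤ x → x ≤ y →
      ‖Complex.exp (-q * x)‖ ≤ Real.exp (max 0 (-q.re) * y) := by
    intro q x y hx hy
    rw [Complex.norm_exp]
    refine Real.exp_le_exp.mpr ?_
    have : (-q * x).re = -q.re * x := by simp
    rw [this]
    calc -q.re * x ≤ max 0 (-q.re) * x := by gcongr; exact le_max_right _ _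
      _ ≤ _ := by gcongr
  refine ⟨P.map T, Measure.isProbabilityMeasure_map hTm, ?_, ?_, ?_⟩
  · rw [Measure.map_apply_of_aemeasurable hTm measurableSet_Iio]
    refine measure_mono_null ?_ (ae_iff.mp hle)
    intro ω hω hc
    have := hc.1 0
    simp only [Set.mem_preimage, Set.mem_Iio] at hω
    linarith [this.1, this.2]
  -- The sum dominates each summand, so it can vanish only where that summand does. This later
  -- excludes an atom of `C₂` at `0`.
  · intro k
    rw [Measure.map_apply_of_aemeasurable hTm measurableSet_Iic, ← hmap k,
      Measure.map_apply (hX k) measurableSet_Iic]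
    refine measure_mono_ae ?_
    filter_upwards [hle] with ω hω h
    exact (hω.2 k).trans h
  · intro q hq
    -- With `r = max 0 (-Re q)`, the variable `exp(r T)` dominates all the partial sums'
    -- exponentials, whichever sign `Re q` has.
    have hr : max 0 (-q.re) < b := max_lt hb (by linarith)
    have hI := hTint _ (le_max_left 0 (-q.re)) hr
    have hTc : AEStronglyMeasurable (fun ω => Complex.exp (-q * T ω)) P := by
      have : AEMeasurable (fun ω => Complex.exp (-q * T ω)) P := by fun_prop
      exact this.aestronglyMeasurable
    constructor
    · rw [integrable_map_measure (by fun_prop) hTm]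
      refine hI.mono' hTc ?_
      filter_upwards [hle] with ω hω
      exact hbound q _ _ ((hω.1 0).1.trans (hω.1 0).2) le_rfl
    · rw [integral_map hTm (by fun_prop)]
      simp only [← hprodC]
      refine tendsto_integral_of_dominated_convergence _ (fun N => ?_) hI (fun N => ?_) ?_
      · exact (by fun_prop : Measurable fun ω => Complex.exp (-q * S N ω)).aestronglyMeasurable
      · filter_upwards [hle] with ω hω
        exact hbound q _ _ (hω.1 N).1 (hω.1 N).2
      · filter_upwards [hlim] with ω hω
        have h1 : Tendsto (fun N => ((S N ω : ℝ) : ℂ)) atTop (𝓝 (T ω : ℂ)) :=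
          (Complex.continuous_ofReal.tendsto _).comp hω
        exact (Complex.continuous_exp.tendsto _).comp (h1.const_mul (-q))

/-! ### Measures with a density on the half-line -/

/-- The measure on `(0, ∞)` with density `f`. -/
def halfLineDensity (f : ℝ → ℝ) : Measure ℝ :=
  (volume.restrict (Set.Ioi 0)).withDensity fun x => ENNReal.ofReal (f x)

section halfLineDensity

variable {E : Type*} [NormedAddCommGroup E] [NormedSpace ℝ E]

theorem integral_halfLineDensity {f : ℝ → ℝ} (hf : Measurable f) (h0 : ∀ x, 0 < x → 0 ≤ f x)
    (g : ℝ → E) : ∫ x, g x ∂(halfLineDensity f) = ∫ x in Set.Ioi 0, f x • g x := by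
  rw [halfLineDensity, integral_withDensity_eq_integral_toReal_smul (by fun_prop) (by simp)]
  exact setIntegral_congr_fun measurableSet_Ioi fun x hx => by
    simp only [ENNReal.toReal_ofReal (h0 x hx)]

theorem integrable_halfLineDensity_iff {f : ℝ → ℝ} (hf : Measurable f)
    (h0 : ∀ x, 0 < x → 0 ≤ f x) (g : ℝ → E) :
    Integrable g (halfLineDensity f) ↔ IntegrableOn (fun x => f x • g x) (Set.Ioi 0) := by
  rw [halfLineDensity, integrable_withDensity_iff_integrable_smul₀' (by fun_prop) (by simp)]
  exact integrableOn_congr_fun (fun x hx => by simp only [ENNReal.toReal_ofReal (h0 x hx)])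
    measurableSet_Ioi

theorem halfLineDensity_Iic (f : ℝ → ℝ) : halfLineDensity f (Set.Iic 0) = 0 := by
  refine withDensity_absolutelyContinuous _ _ ?_
  rw [Measure.restrict_apply measurableSet_Iic, Set.Iic_inter_Ioi, Set.Ioc_self, measure_empty]

theorem halfLineDensity_univ {f : ℝ → ℝ} (h0 : ∀ x, 0 < x → 0 ≤ f x)
    (hi : IntegrableOn f (Set.Ioi 0)) :
    halfLineDensity f Set.univ = ENNReal.ofReal (∫ x in Set.Ioi 0, f x) := by
  rw [halfLineDensity, withDensity_apply _ MeasurableSet.univ, Measure.restrict_univ,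
    ofReal_integral_eq_lintegral_ofReal hi]
  filter_upwards [ae_restrict_mem measurableSet_Ioi] with x hx using h0 x hx

end halfLineDensity

/-! ### Euler's product for the cosine and the `C₂` law -/

/-- Divide Euler's sine product at `2z`, cut off after `2n` factors, by the one at `z`, cut off
after `n`: the even-indexed factors cancel, the odd ones remain, and `sin 2x / (2 sin x) = cos x`.
-/
theorem tendsto_euler_cos_prod {z : ℂ} (hz : Complex.sin (Real.pi * z) ≠ 0) :
    Tendsto (fun n => ∏ k ∈ Finset.range n, (1 - 4 * z ^ 2 / (2 * (k : ℂ) + 1) ^ 2)) atTop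
      (𝓝 (Complex.cos (Real.pi * z))) := by
  have h1 := Complex.tendsto_euler_sin_prod z
  have h2 := (Complex.tendsto_euler_sin_prod (2 * z)).comp
    (tendsto_id.nsmul_atTop (n := 2) (by norm_num))
  have h3 := h2.div h1 hz
  have hlim : Complex.sin (Real.pi * (2 * z)) / Complex.sin (Real.pi * z) =
      2 * Complex.cos (Real.pi * z) := by
    rw [show (Real.pi : ℂ) * (2 * z) = 2 * (Real.pi * z) by ring, Complex.sin_two_mul]
    field_simp
  rw [hlim] at h3
  have h4 := h3.const_mul (1 / 2 : ℂ)
  rw [show 1 / 2 * (2 * Complex.cos (Real.pi * z)) = Complex.cos (Real.pi * z) by ring] at h4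
  have hsplit : ∀ n : ℕ, ∏ j ∈ Finset.range (2 * n), (1 - (2 * z) ^ 2 / ((j : ℂ) + 1) ^ 2) =
      (∏ k ∈ Finset.range n, (1 - 4 * z ^ 2 / (2 * (k : ℂ) + 1) ^ 2)) *
        ∏ k ∈ Finset.range n, (1 - z ^ 2 / ((k : ℂ) + 1) ^ 2) := by
    intro n
    induction n with
    | zero => simp
    | succ n ih =>
      rw [show 2 * (n + 1) = 2 * n + 1 + 1 by ring, Finset.prod_range_succ, Finset.prod_range_succ,
        ih, Finset.prod_range_succ, Finset.prod_range_succ]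
      have h5 : (1 - (2 * z) ^ 2 / (((2 * n + 1 : ℕ) : ℂ) + 1) ^ 2) =
          1 - z ^ 2 / ((n : ℂ) + 1) ^ 2 := by
        have : (n : ℂ) + 1 ≠ 0 := by exact_mod_cast Nat.succ_ne_zero n
        push_cast
        rw [show (2 * (n : ℂ) + 1 + 1) = 2 * (n + 1) by ring]
        field_simp
      rw [h5]
      push_cast
      ring
  refine h4.congr' ?_
  filter_upwards [h1.eventually_ne hz] with n hn
  simp only [Pi.div_apply, Function.comp_apply, id, smul_eq_mul, hsplit]
  have h6 := left_ne_zero_of_mul hn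
  have h7 := right_ne_zero_of_mul hn
  rw [← mul_assoc _ (∏ k ∈ Finset.range n, (1 - 4 * z ^ 2 / (2 * (k : ℂ) + 1) ^ 2)),
    mul_div_mul_right _ _ h7, show (Real.pi : ℂ) * (2 * z) = 2 * (Real.pi * z) by ring, mul_assoc 2,
    mul_div_assoc, mul_div_cancel_left₀ _ h6]
  ring

/-- The rates of the exponential variables which make up the `C₂` law. -/
def c2Rate (k : ℕ) : ℝ := Real.pi ^ 2 * (2 * k + 1) ^ 2 / 8

/-- The smallest rate is `π²/8 > 9/8`. A bound uniform in `k` makes exponential moments of every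
order below `1` available to all the summands. -/
theorem one_lt_c2Rate (k : ℕ) : 1 < c2Rate k := by
  have h1 : (0 : ℝ) ≤ k := Nat.cast_nonneg k
  have h2 := Real.pi_gt_three
  unfold c2Rate
  rw [lt_div_iff₀ (by norm_num)]
  have h3 : (9 : ℝ) < Real.pi ^ 2 := by nlinarith
  have h4 : (1 : ℝ) ≤ (2 * k + 1) ^ 2 := by nlinarith
  nlinarith

/-- Euler's product at the imaginary point `z = i√(2q)/π`, where `-4z²/(2k+1)² = q/c2Rate k`. -/
theorem tendsto_prod_c2Rate_cosh {q : ℝ} (hq : 0 < q) :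
    Tendsto (fun n => ∏ k ∈ Finset.range n, (1 + q / c2Rate k)) atTop
      (𝓝 (Real.cosh (Real.sqrt (2 * q)))) := by
  have hs : 0 < Real.sqrt (2 * q) := Real.sqrt_pos.mpr (by linarith)
  have hpi : (Real.pi : ℂ) ≠ 0 := by exact_mod_cast Real.pi_ne_zero
  have harg : (Real.pi : ℂ) * (Real.sqrt (2 * q) / Real.pi * Complex.I) =
      Real.sqrt (2 * q) * Complex.I := by field_simp
  have h := tendsto_euler_cos_prod (z := Real.sqrt (2 * q) / Real.pi * Complex.I) (by
    rw [harg, Complex.sin_mul_I]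
    refine mul_ne_zero ?_ Complex.I_ne_zero
    rw [← Complex.ofReal_sinh]
    exact_mod_cast (Real.sinh_pos_iff.mpr hs).ne')
  rw [harg, Complex.cos_mul_I, ← Complex.ofReal_cosh] at h
  have h2 := (Complex.continuous_re.tendsto _).comp h
  simp only [Complex.ofReal_re] at h2
  refine h2.congr fun n => ?_
  have : ∀ k : ℕ, (1 - 4 * ((Real.sqrt (2 * q) / Real.pi * Complex.I : ℂ)) ^ 2 /
      (2 * (k : ℂ) + 1) ^ 2) = ((1 + q / c2Rate k : ℝ) : ℂ) := by
    intro k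
    have e : ((Real.sqrt (2 * q) : ℝ) : ℂ) ^ 2 = 2 * q := by
      rw [← Complex.ofReal_pow, Real.sq_sqrt (by linarith)]; push_cast; ring
    rw [mul_pow, div_pow, Complex.I_sq, e]
    unfold c2Rate
    push_cast
    have : (2 * (k : ℂ) + 1) ≠ 0 := by exact_mod_cast Nat.succ_ne_zero (2 * k)
    field_simp
    ring
  simp only [Function.comp_apply, this]
  rw [← Complex.ofReal_prod, Complex.ofReal_re]

/-- The same product at a real point. Positivity of the limit, from `√(2r) < 3/2 < π/2`, keeps the
inverse products bounded, as `exists_law_tsum` requires. -/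
theorem tendsto_prod_c2Rate_cos {r : ℝ} (h0 : 0 < r) (h1 : r < 1) :
    Tendsto (fun n => ∏ k ∈ Finset.range n, (1 - r / c2Rate k)) atTop
      (𝓝 (Real.cos (Real.sqrt (2 * r)))) ∧ 0 < Real.cos (Real.sqrt (2 * r)) := by
  have hs : 0 < Real.sqrt (2 * r) := Real.sqrt_pos.mpr (by linarith)
  have hs2 : Real.sqrt (2 * r) < 3 / 2 := by
    rw [Real.sqrt_lt' (by norm_num)]; linarith
  have hpi3 := Real.pi_gt_three
  have hpi : (Real.pi : ℂ) ≠ 0 := by exact_mod_cast Real.pi_ne_zero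
  have harg : (Real.pi : ℂ) * (Real.sqrt (2 * r) / Real.pi) = Real.sqrt (2 * r) := by field_simp
  refine ⟨?_, Real.cos_pos_of_mem_Ioo ⟨by linarith, by linarith⟩⟩
  have h := tendsto_euler_cos_prod (z := Real.sqrt (2 * r) / Real.pi) (by
    rw [harg, ← Complex.ofReal_sin]
    exact_mod_cast (Real.sin_pos_of_pos_of_lt_pi hs (by linarith)).ne')
  rw [harg, ← Complex.ofReal_cos] at h
  have h2 := (Complex.continuous_re.tendsto _).comp h
  simp only [Complex.ofReal_re] at h2
  refine h2.congr fun n => ?_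
  have : ∀ k : ℕ, (1 - 4 * ((Real.sqrt (2 * r) / Real.pi : ℂ)) ^ 2 /
      (2 * (k : ℂ) + 1) ^ 2) = ((1 - r / c2Rate k : ℝ) : ℂ) := by
    intro k
    have e : ((Real.sqrt (2 * r) : ℝ) : ℂ) ^ 2 = 2 * r := by
      rw [← Complex.ofReal_pow, Real.sq_sqrt (by linarith)]; push_cast; ring
    rw [div_pow, e]
    unfold c2Rate
    push_cast
    have : (2 * (k : ℂ) + 1) ≠ 0 := by exact_mod_cast Nat.succ_ne_zero (2 * k)
    field_simp
    ring
  simp only [Function.comp_apply, this]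
  rw [← Complex.ofReal_prod, Complex.ofReal_re]

theorem integrableOn_id_mul_exp_neg {l : ℝ} (hl : 0 < l) :
    IntegrableOn (fun x : ℝ => x * Real.exp (-l * x)) (Set.Ioi 0) := by
  have := integrableOn_rpow_mul_exp_neg_mul_rpow (p := 1) (s := 1) (b := l) (by norm_num)
    (by norm_num) hl
  simpa using this

theorem integral_id_mul_exp_neg {l : ℝ} (hl : 0 < l) :
    ∫ x in Set.Ioi (0 : ℝ), x * Real.exp (-l * x) = 1 / l ^ 2 := by
  have := Real.integral_rpow_mul_exp_neg_mul_Ioi (a := 2) (r := l) (by norm_num) hl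
  norm_num [Real.Gamma_two] at this
  simpa [neg_mul] using this

/-- `C₂` is the law of a sum of independent Gamma variables of shape `2` and rates `c2Rate k`: their
Laplace transforms `(1 + q/c2Rate k)^{-2}` multiply to `1/cosh² √(2q)`. -/
theorem exists_isC2 : ∃ μ : Measure ℝ, IsC2 μ := by
  set f : ℕ → ℝ → ℝ := fun k x => c2Rate k ^ 2 * (x * Real.exp (-c2Rate k * x)) with hf
  have hl : ∀ k, 0 < c2Rate k := fun k => one_pos.trans (one_lt_c2Rate k)
  have hfm : ∀ k, Measurable (f k) := fun k => by fun_prop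
  have hf0 : ∀ k x, 0 < x → 0 ≤ f k x := fun k x hx => by positivity
  have hmul : ∀ k (r x : ℝ), f k x • Real.exp (r * x) =
      c2Rate k ^ 2 * (x * Real.exp (-(c2Rate k - r) * x)) := by
    intro k r x
    rw [show -(c2Rate k - r) * x = -c2Rate k * x + r * x by ring, Real.exp_add, smul_eq_mul]
    ring
  have hint : ∀ k r, r < 1 → Integrable (fun x => Real.exp (r * x)) (halfLineDensity (f k)) := by
    intro k r hr
    rw [integrable_halfLineDensity_iff (hfm k) (hf0 k)]
    simp only [hmul]
    exact (integrableOn_id_mul_exp_neg (by linarith [one_lt_c2Rate k])).const_mul _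
  have hval : ∀ k r, r < 1 → ∫ x, Real.exp (r * x) ∂(halfLineDensity (f k)) =
      ((1 - r / c2Rate k)⁻¹) ^ 2 := by
    intro k r hr
    have := one_lt_c2Rate k
    rw [integral_halfLineDensity (hfm k) (hf0 k)]
    simp only [hmul]
    rw [integral_const_mul, integral_id_mul_exp_neg (by linarith)]
    have h1 : c2Rate k - r ≠ 0 := by linarith
    have h2 := (hl k).ne'
    have h3 : 1 - r / c2Rate k ≠ 0 := by
      rw [one_sub_div h2]; exact div_ne_zero h1 h2
    field_simp
  have hprob : ∀ k, IsProbabilityMeasure (halfLineDensity (f k)) := by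
    intro k
    constructor
    rw [halfLineDensity_univ (hf0 k) ((integrableOn_id_mul_exp_neg (hl k)).const_mul _), hf]
    simp only
    rw [integral_const_mul, integral_id_mul_exp_neg (hl k)]
    have h2 := (hl k).ne'
    field_simp
    simp
  obtain ⟨μ, h1, h2, h3, h4⟩ := exists_law_tsum (fun k => halfLineDensity (f k))
    (fun k => measure_mono_null Set.Iio_subset_Iic_self (halfLineDensity_Iic _)) one_pos
    (fun k r hr => hint k r hr) (by
      intro r h0 hr
      simp only [hval _ r hr, Finset.prod_pow, Finset.prod_inv_distrib]
      rcases h0.eq_or_lt with rfl | h0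
      · exact ⟨1, fun N => by simp⟩
      obtain ⟨ht, hc⟩ := tendsto_prod_c2Rate_cos h0 hr
      obtain ⟨C, hC⟩ := ((ht.inv₀ hc.ne').pow 2).bddAbove_range
      exact ⟨C, fun N => hC ⟨N, rfl⟩⟩)
  refine ⟨μ, h1, ?_, fun q hq => ?_⟩
  · rw [Set.compl_Ioi]
    exact le_antisymm ((h3 0).trans (halfLineDensity_Iic _).le) zero_le
  · have h5 := (h4 q (by simp; linarith)).2
    have e : ∀ x : ℝ, Complex.exp (-(q : ℂ) * x) = (Real.exp (-q * x) : ℂ) := fun x => by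
      push_cast; ring_nf
    simp only [e, integral_complex_ofReal, hval _ (-q) (by linarith : -q < 1),
      ← Complex.ofReal_prod] at h5
    have h6 := (Complex.continuous_re.tendsto _).comp h5
    have h7 : Tendsto (fun n => ((∏ k ∈ Finset.range n, (1 + q / c2Rate k))⁻¹) ^ 2) atTop
        (𝓝 ((1 / Real.cosh (Real.sqrt (2 * q))) ^ 2)) := by
      rw [one_div]
      exact ((tendsto_prod_c2Rate_cosh hq).inv₀ (Real.cosh_pos _).ne').pow 2
    refine tendsto_nhds_unique h6 (h7.congr fun n => ?_)
    simp only [Function.comp_apply, Complex.ofReal_re, Finset.prod_pow, Finset.prod_inv_distrib,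
      neg_div, sub_neg_eq_add]

theorem isC2_distC2 : IsC2 distC2 := by
  rw [distC2, dif_pos exists_isC2]
  exact exists_isC2.choose_spec

/-! ### Negative moments of the `C₂` law -/

/-- `∫₀^∞ u^{p-1} / cosh² u du`. -/
def sechMoment (p : ℝ) : ℝ := ∫ u in Set.Ioi (0 : ℝ), u ^ (p - 1) * (1 / Real.cosh u) ^ 2

theorem one_div_cosh_le (u : ℝ) : 1 / Real.cosh u ≤ 2 * Real.exp (-u) := by
  rw [div_le_iff₀ (Real.cosh_pos u), Real.cosh_eq]
  have : Real.exp (-u) * Real.exp u = 1 := by rw [← Real.exp_add]; simp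
  nlinarith [Real.exp_pos (-u), sq_nonneg (Real.exp (-u))]

theorem one_div_cosh_sq_le (u : ℝ) : (1 / Real.cosh u) ^ 2 ≤ 4 * Real.exp (-2 * u) := by
  have h := pow_le_pow_left₀ (by positivity [Real.cosh_pos u]) (one_div_cosh_le u) 2
  refine h.trans (le_of_eq ?_)
  rw [mul_pow, ← Real.exp_nat_mul]
  ring_nf

theorem integrableOn_sechMoment {p : ℝ} (hp : 0 < p) :
    IntegrableOn (fun u : ℝ => u ^ (p - 1) * (1 / Real.cosh u) ^ 2) (Set.Ioi 0) := by
  have h := (integrableOn_rpow_mul_exp_neg_mul_rpow (p := 1) (s := p - 1) (b := 2) (by linarith)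
    (by norm_num) (by norm_num)).const_mul 4
  refine Integrable.mono' h (by fun_prop) ?_
  filter_upwards [ae_restrict_mem measurableSet_Ioi] with u hu
  have hu : 0 < u := hu
  rw [Real.norm_of_nonneg (by positivity)]
  have := one_div_cosh_sq_le u
  calc u ^ (p - 1) * (1 / Real.cosh u) ^ 2 ≤ u ^ (p - 1) * (4 * Real.exp (-2 * u)) := by gcongr
    _ = _ := by simp; ring

/-- Substitution `u = √(2q)`, carried out as a square root followed by a dilation by `2`. -/
theorem integral_rpow_mul_one_div_cosh_sqrt {s : ℝ} (hs : 0 < s) :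
    IntegrableOn (fun q : ℝ => q ^ (s - 1) * (1 / Real.cosh (Real.sqrt (2 * q))) ^ 2)
      (Set.Ioi 0) ∧
    ∫ q in Set.Ioi (0 : ℝ), q ^ (s - 1) * (1 / Real.cosh (Real.sqrt (2 * q))) ^ 2 =
      2 ^ (1 - s) * sechMoment (2 * s) := by
  set g : ℝ → ℝ := fun u => u ^ (2 * s - 1) * (1 / Real.cosh u) ^ 2 with hg
  set F : ℝ → ℝ := fun y => (|(1 / 2 : ℝ)| * y ^ ((1 / 2 : ℝ) - 1)) • g (y ^ (1 / 2 : ℝ)) with hF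
  have hgi : IntegrableOn g (Set.Ioi 0) := integrableOn_sechMoment (by linarith)
  have h1 : IntegrableOn F (Set.Ioi 0) :=
    (integrableOn_Ioi_comp_rpow_iff g (by norm_num)).mpr hgi
  have h2 : ∫ y in Set.Ioi 0, F y = sechMoment (2 * s) := integral_comp_rpow_Ioi g (by norm_num)
  have h3 : IntegrableOn (fun q => F (2 * q)) (Set.Ioi 0) := by
    rw [integrableOn_Ioi_comp_mul_left_iff F 0 (by norm_num : (0 : ℝ) < 2)]
    simpa using h1
  have h4 : ∫ q in Set.Ioi 0, F (2 * q) = 2⁻¹ * sechMoment (2 * s) := by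
    rw [integral_comp_mul_left_Ioi F 0 (by norm_num : (0 : ℝ) < 2)]
    simp [h2]
  have h5 : ∀ q ∈ Set.Ioi (0 : ℝ), (2 : ℝ) ^ (2 - s) * F (2 * q) =
      q ^ (s - 1) * (1 / Real.cosh (Real.sqrt (2 * q))) ^ 2 := by
    intro q hq
    have hq : 0 < q := hq
    have h2q : 0 < 2 * q := by linarith
    simp only [hF, hg, ← Real.sqrt_eq_rpow, smul_eq_mul]
    rw [Real.sqrt_eq_rpow, ← Real.rpow_mul h2q.le]
    have e1 : (2 : ℝ) ^ (2 - s) * (|(1 / 2 : ℝ)| * (2 * q) ^ ((1 / 2 : ℝ) - 1) *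
        (2 * q) ^ (1 / 2 * (2 * s - 1))) = q ^ (s - 1) := by
      rw [mul_assoc |(1 / 2 : ℝ)|, ← Real.rpow_add h2q, Real.mul_rpow (by norm_num) hq.le,
        show (1 / 2 : ℝ) - 1 + 1 / 2 * (2 * s - 1) = s - 1 by ring,
        abs_of_pos (by norm_num : (0 : ℝ) < 1 / 2)]
      have : (2 : ℝ) ^ (2 - s) * 2 ^ (s - 1) = 2 := by
        rw [← Real.rpow_add (by norm_num)]; norm_num
      linear_combination (1 / 2 * q ^ (s - 1)) * this
    rw [← e1]
    ring
  constructor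
  · exact (integrableOn_congr_fun h5 measurableSet_Ioi).mp (h3.const_mul _)
  · rw [← setIntegral_congr_fun measurableSet_Ioi h5, integral_const_mul, h4, ← mul_assoc]
    congr 1
    rw [show (2 : ℝ) - s = 1 - s + 1 by ring, Real.rpow_add (by norm_num)]
    norm_num
    ring

/-- Write `Γ(s) x^{-s} = ∫₀^∞ q^{s-1} e^{-qx} dq` and exchange with the expectation by Tonelli; the
inner expectation is then the Laplace transform of `C₂`. Working with `∫⁻` yields finiteness and
value together. -/
theorem IsC2.negative_moment {μ : Measure ℝ} (hμ : IsC2 μ) {s : ℝ} (hs : 0 < s) :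
    Integrable (fun x : ℝ => x ^ (-s)) μ ∧
      Real.Gamma s * ∫ x : ℝ, x ^ (-s) ∂μ = 2 ^ (1 - s) * sechMoment (2 * s) := by
  have := hμ.isProbabilityMeasure
  have hpos : ∀ᵐ x ∂μ, 0 < x := by
    rw [ae_iff]; simpa [Set.compl_def] using hμ.support
  obtain ⟨hI, hV⟩ := integral_rpow_mul_one_div_cosh_sqrt hs
  have hG := Real.Gamma_pos_of_pos hs
  have h1 : ∀ᵐ x ∂μ, ∫⁻ q in Set.Ioi (0 : ℝ), ENNReal.ofReal (q ^ (s - 1) * Real.exp (-q * x)) =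
      ENNReal.ofReal (Real.Gamma s * x ^ (-s)) := by
    filter_upwards [hpos] with x hx
    have e : ∀ q : ℝ, q ^ (s - 1) * Real.exp (-q * x) = q ^ (s - 1) * Real.exp (-(x * q)) :=
      fun q => by ring_nf
    have hi : IntegrableOn (fun q : ℝ => q ^ (s - 1) * Real.exp (-(x * q))) (Set.Ioi 0) := by
      have := integrableOn_rpow_mul_exp_neg_mul_rpow (p := 1) (s := s - 1) (b := x) (by linarith)
        (by norm_num) hx
      simpa [neg_mul] using this
    simp only [e]
    rw [← ofReal_integral_eq_lintegral_ofReal hi, Real.integral_rpow_mul_exp_neg_mul_Ioi hs hx]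
    · rw [one_div, Real.inv_rpow hx.le, Real.rpow_neg hx.le, mul_comm]
    · filter_upwards [ae_restrict_mem measurableSet_Ioi] with q hq
      have : 0 < q := hq
      positivity
  have h2 : ∀ q ∈ Set.Ioi (0 : ℝ), ∫⁻ x, ENNReal.ofReal (q ^ (s - 1) * Real.exp (-q * x)) ∂μ =
      ENNReal.ofReal (q ^ (s - 1) * (1 / Real.cosh (Real.sqrt (2 * q))) ^ 2) := by
    intro q hq
    have hq : 0 < q := hq
    rw [← ofReal_integral_eq_lintegral_ofReal, integral_const_mul, hμ.laplace q hq]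
    · refine Integrable.const_mul ?_ _
      refine Integrable.mono' (integrable_const 1) (by fun_prop) ?_
      filter_upwards [hpos] with x hx
      rw [Real.norm_of_nonneg (Real.exp_pos _).le, Real.exp_le_one_iff]
      nlinarith
    · exact ae_of_all _ fun x => by positivity
  have h3 : ∫⁻ x, ENNReal.ofReal (Real.Gamma s * x ^ (-s)) ∂μ =
      ENNReal.ofReal (2 ^ (1 - s) * sechMoment (2 * s)) := by
    rw [← lintegral_congr_ae h1, lintegral_lintegral_swap (by fun_prop),
      setLIntegral_congr_fun measurableSet_Ioi h2, ← hV, ofReal_integral_eq_lintegral_ofReal hI]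
    filter_upwards [ae_restrict_mem measurableSet_Ioi] with q hq
    have : 0 < q := hq
    positivity
  have h4 : 0 ≤ᵐ[μ] fun x => Real.Gamma s * x ^ (-s) := by
    filter_upwards [hpos] with x hx
    positivity
  have h5 : Integrable (fun x : ℝ => Real.Gamma s * x ^ (-s)) μ := by
    refine ⟨by fun_prop, ?_⟩
    rw [hasFiniteIntegral_iff_ofReal h4, h3]
    exact ENNReal.ofReal_lt_top
  constructor
  · have := h5.const_mul (Real.Gamma s)⁻¹
    simpa [← mul_assoc, inv_mul_cancel₀ hG.ne'] using this
  · rw [← integral_const_mul, integral_eq_lintegral_of_nonneg_ae h4 h5.1, h3,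
      ENNReal.toReal_ofReal]
    refine mul_nonneg (by positivity) (setIntegral_nonneg measurableSet_Ioi fun u hu => ?_)
    have : 0 < u := hu
    positivity

/-! ### Complex Laplace transforms -/

theorem differentiableAt_laplace {h : ℝ → ℂ} {c : ℝ}
    (hm : AEStronglyMeasurable h (volume.restrict (Set.Ioi 0)))
    (hint : ∀ r : ℝ, c < r → IntegrableOn (fun t => Real.exp (-r * t) * ‖h t‖) (Set.Ioi 0))
    {q : ℂ} (hq : c < q.re) :
    DifferentiableAt ℂ (fun z : ℂ => ∫ t in Set.Ioi (0 : ℝ), Complex.exp (-z * t) * h t) q := by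
  -- One `ε` for the radius of the ball, one to absorb the factor `t ≤ ε⁻¹ e^{εt}`, and one to
  -- remain to the right of `c`.
  set ε : ℝ := (q.re - c) / 3 with hε
  have hε0 : 0 < ε := by rw [hε]; linarith
  have hcont : ∀ z : ℂ, AEStronglyMeasurable (fun t : ℝ => Complex.exp (-z * t))
      (volume.restrict (Set.Ioi 0)) := fun z => by
    exact (by fun_prop : Measurable fun t : ℝ => Complex.exp (-z * t)).aestronglyMeasurable
  have key := hasDerivAt_integral_of_dominated_loc_of_deriv_le
    (μ := volume.restrict (Set.Ioi (0 : ℝ)))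
    (F := fun (z : ℂ) (t : ℝ) => Complex.exp (-z * t) * h t)
    (F' := fun (z : ℂ) (t : ℝ) => -t * Complex.exp (-z * t) * h t)
    (bound := fun t => ε⁻¹ * (Real.exp (-(q.re - 2 * ε) * t) * ‖h t‖))
    (x₀ := q) (s := Metric.ball q ε) (Metric.ball_mem_nhds q hε0)
    (Eventually.of_forall fun z => (hcont z).mul hm) ?_ ?_ ?_ ?_ ?_
  · exact key.2.differentiableAt
  · refine (hint q.re hq).mono' ((hcont q).mul hm) (ae_of_all _ fun t => ?_)
    rw [norm_mul, Complex.norm_exp]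
    simp
  · refine AEStronglyMeasurable.mul (AEStronglyMeasurable.mul ?_ (hcont q)) hm
    exact (by fun_prop : Measurable fun t : ℝ => -(t : ℂ)).aestronglyMeasurable
  · filter_upwards [ae_restrict_mem measurableSet_Ioi] with t ht z hz
    have ht : 0 < t := ht
    have h1 : q.re - ε < z.re := by
      have h2 := (Complex.abs_re_le_norm (z - q)).trans_lt (mem_ball_iff_norm.mp hz)
      rw [Complex.sub_re] at h2
      linarith [(abs_lt.mp h2).1]
    rw [norm_mul, norm_mul, Complex.norm_exp, norm_neg, Complex.norm_real, Real.norm_of_nonneg ht.le,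
      ← mul_assoc]
    refine mul_le_mul_of_nonneg_right ?_ (norm_nonneg _)
    have h3 : (-z * (t : ℂ)).re = -z.re * t := by simp
    rw [h3]
    have h4 : t ≤ ε⁻¹ * Real.exp (ε * t) := by
      rw [inv_mul_eq_div, le_div_iff₀ hε0]
      linarith [Real.add_one_le_exp (ε * t)]
    calc t * Real.exp (-z.re * t) ≤ ε⁻¹ * Real.exp (ε * t) * Real.exp (-(q.re - ε) * t) := by
          gcongr
      _ = ε⁻¹ * Real.exp (-(q.re - 2 * ε) * t) := by
          rw [mul_assoc, ← Real.exp_add]; ring_nf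
  · exact (hint _ (by rw [hε]; linarith)).const_mul _
  · refine ae_of_all _ fun t z _ => ?_
    have h1 : HasDerivAt (fun z : ℂ => -z * t) (-t) z := by
      simpa using ((hasDerivAt_id z).neg.mul_const (t : ℂ))
    have h2 := h1.cexp.mul_const (h t)
    rwa [mul_comm (Complex.exp _)] at h2

/-- Both sides are holomorphic in `w` on the right half-plane and agree for real `w > 0`, in
particular along `1 + 1/(n+1) → 1`; the identity theorem does the rest. -/
theorem integral_cpow_mul_cexp_neg_mul_Ioi {s w : ℂ} (hs : 0 < s.re) (hw : 0 < w.re) :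
    ∫ t in Set.Ioi (0 : ℝ), (t : ℂ) ^ (s - 1) * Complex.exp (-w * t) =
      w ^ (-s) * Complex.Gamma s := by
  have hU : IsOpen {z : ℂ | 0 < z.re} := isOpen_lt continuous_const Complex.continuous_re
  have hUc : IsPreconnected {z : ℂ | 0 < z.re} := (convex_halfSpace_re_gt 0).isPreconnected
  have hpow : AEStronglyMeasurable (fun t : ℝ => (t : ℂ) ^ (s - 1))
      (volume.restrict (Set.Ioi 0)) := by
    exact (by fun_prop : Measurable fun t : ℝ => (t : ℂ) ^ (s - 1)).aestronglyMeasurable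
  have hf : DifferentiableOn ℂ
      (fun z : ℂ => ∫ t in Set.Ioi (0 : ℝ), Complex.exp (-z * t) * (t : ℂ) ^ (s - 1))
      {z : ℂ | 0 < z.re} := by
    intro z hz
    refine (differentiableAt_laplace (c := 0) hpow (fun r hr => ?_) hz).differentiableWithinAt
    have := integrableOn_rpow_mul_exp_neg_mul_rpow (p := 1) (s := s.re - 1) (b := r) (by linarith)
      (by norm_num) hr
    refine this.congr_fun (fun t ht => ?_) measurableSet_Ioi
    have ht : 0 < t := ht
    simp [Complex.norm_cpow_eq_rpow_re_of_pos ht, mul_comm]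
  have hg : DifferentiableOn ℂ (fun z : ℂ => z ^ (-s) * Complex.Gamma s) {z : ℂ | 0 < z.re} := by
    intro z hz
    refine DifferentiableAt.differentiableWithinAt ?_
    exact (differentiableAt_id.cpow_const (Or.inl hz)).mul_const _
  have hreal : ∀ r : ℝ, 0 < r →
      ∫ t in Set.Ioi (0 : ℝ), Complex.exp (-(r : ℂ) * t) * (t : ℂ) ^ (s - 1) =
        (r : ℂ) ^ (-s) * Complex.Gamma s := by
    intro r hr
    have := Complex.integral_cpow_mul_exp_neg_mul_Ioi hs hr
    rw [one_div, Complex.inv_cpow _ _ (by rw [Complex.arg_ofReal_of_nonneg hr.le]; positivity),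
      ← Complex.cpow_neg] at this
    rw [← this]
    refine integral_congr_ae (ae_of_all _ fun t => ?_)
    simp only [neg_mul]
    rw [mul_comm]
  have hfreq : ∃ᶠ z in 𝓝[≠] (1 : ℂ),
      ∫ t in Set.Ioi (0 : ℝ), Complex.exp (-z * t) * (t : ℂ) ^ (s - 1) =
        z ^ (-s) * Complex.Gamma s := by
    have hlim : Tendsto (fun n : ℕ => ((1 + 1 / ((n : ℝ) + 1) : ℝ) : ℂ)) atTop (𝓝[≠] (1 : ℂ)) := by
      rw [tendsto_nhdsWithin_iff]
      constructor
      · have := (tendsto_one_div_add_atTop_nhds_zero_nat (𝕜 := ℝ)).const_add 1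
        have h2 := (Complex.continuous_ofReal.tendsto _).comp this
        simpa [Function.comp_def] using h2
      · refine Eventually.of_forall fun n h => ?_
        have h1 : (1 + 1 / ((n : ℝ) + 1) : ℝ) = 1 := by
          rw [Set.mem_singleton_iff] at h
          exact_mod_cast h
        have h2 : (0 : ℝ) < 1 / ((n : ℝ) + 1) := by positivity
        linarith
    refine hlim.frequently (Frequently.of_forall fun n => hreal _ (by positivity))
  have := (hf.analyticOnNhd hU).eqOn_of_preconnected_of_frequently_eq (hg.analyticOnNhd hU) hUc
    (by simp) hfreq hw
  simp only at this
  rw [← this]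
  refine integral_congr_ae (ae_of_all _ fun t => ?_)
  simp only [mul_comm]

theorem mellinConvergent_cexp {s w : ℂ} (hs : 0 < s.re) (hw : 0 < w.re) :
    MellinConvergent (fun t : ℝ => Complex.exp (-w * t)) s := by
  have := integrableOn_rpow_mul_exp_neg_mul_rpow (p := 1) (s := s.re - 1) (b := w.re) (by linarith)
      (by norm_num) hw
  refine Integrable.mono' this ?_ ?_
  · exact (by fun_prop : Measurable fun t : ℝ =>
      (t : ℂ) ^ (s - 1) • Complex.exp (-w * t)).aestronglyMeasurable
  · filter_upwards [ae_restrict_mem measurableSet_Ioi] with t ht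
    have ht : 0 < t := ht
    rw [norm_smul, Complex.norm_cpow_eq_rpow_re_of_pos ht, Complex.norm_exp]
    simp

theorem mellin_cexp {s w : ℂ} (hs : 0 < s.re) (hw : 0 < w.re) :
    mellin (fun t : ℝ => Complex.exp (-w * t)) s = w ^ (-s) * Complex.Gamma s :=
  integral_cpow_mul_cexp_neg_mul_Ioi hs hw

/-! ### The Barnes double series as a Mellin transform -/

/-- `e^{-wt} / (1 - e^{-t})²`. -/
def barnesKernel (w : ℂ) (t : ℝ) : ℂ := Complex.exp (-w * t) / (1 - Complex.exp (-t)) ^ 2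

theorem norm_cexp_neg_lt_one {t : ℝ} (ht : 0 < t) : ‖Complex.exp (-(t : ℂ))‖ < 1 := by
  rw [Complex.norm_exp]; simpa using ht

theorem hasSum_barnesKernel (w : ℂ) {t : ℝ} (ht : 0 < t) :
    HasSum (fun k : ℕ × ℕ => Complex.exp (-(w + k.1 + k.2) * t)) (barnesKernel w t) := by
  have h1 := hasSum_geometric_of_norm_lt_one (norm_cexp_neg_lt_one ht)
  have h1n : Summable fun n : ℕ => ‖Complex.exp (-(t : ℂ)) ^ n‖ := by
    simpa [norm_pow] using summable_geometric_of_lt_one (norm_nonneg _) (norm_cexp_neg_lt_one ht)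
  have h2 := h1.mul h1 (summable_mul_of_summable_norm h1n h1n)
  have h3 := h2.mul_left (Complex.exp (-w * t))
  rw [barnesKernel, div_eq_mul_inv, sq, mul_inv]
  refine h3.congr_fun fun k => ?_
  rw [← Complex.exp_nat_mul, ← Complex.exp_nat_mul, ← Complex.exp_add, ← Complex.exp_add]
  ring_nf

/-- Half of the exponent goes to each index: `x+k₁+k₂` is at least `x+k₁` and at least `x+k₂`, so
the double series is dominated by a product of two series with exponent `σ/2 > 1`. -/
theorem summable_barnes_rpow {x σ : ℝ} (hx : 0 < x) (hσ : 2 < σ) :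
    Summable fun k : ℕ × ℕ => (x + k.1 + k.2) ^ (-σ) := by
  have h1 : Summable fun n : ℕ => (x + n) ^ (-(σ / 2)) := by
    have := (Real.summable_one_div_nat_add_rpow x (σ / 2)).mpr (by linarith)
    refine this.congr fun n => ?_
    have hn : (0 : ℝ) ≤ n := Nat.cast_nonneg n
    rw [abs_of_pos (by linarith), Real.rpow_neg (by linarith), one_div, add_comm]
  have h2 := h1.mul_of_nonneg h1 (fun n => by positivity) (fun n => by positivity)
  refine Summable.of_nonneg_of_le (fun k => by positivity) (fun k => ?_) h2
  have ha : (0 : ℝ) ≤ k.1 := Nat.cast_nonneg _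
  have hb : (0 : ℝ) ≤ k.2 := Nat.cast_nonneg _
  have e : (x + k.1 + k.2) ^ (-σ) =
      (x + k.1 + k.2) ^ (-(σ / 2)) * (x + k.1 + k.2) ^ (-(σ / 2)) := by
    rw [← Real.rpow_add (by positivity)]; ring_nf
  rw [e]
  gcongr ?_ * ?_
  · exact Real.rpow_le_rpow_of_nonpos (by positivity) (by linarith) (by linarith)
  · exact Real.rpow_le_rpow_of_nonpos (by positivity) (by linarith) (by linarith)

theorem barnesSeries_one_one (s w : ℂ) :
    barnesSeries ![1, 1] s w = ∑' k : ℕ × ℕ, (w + k.1 + k.2) ^ (-s) := by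
  rw [barnesSeries, ← (finTwoArrowEquiv ℕ).tsum_eq]
  refine tsum_congr fun k => ?_
  simp [Fin.sum_univ_two, add_assoc]

/-- Termwise integration of the double geometric series. The norms of the terms integrate to `(Re w
+ k₁ + k₂)^{-Re s} Γ(Re s)`, which is summable for `Re s > 2`. -/
theorem mellin_barnesKernel {s w : ℂ} (hs : 2 < s.re) (hw : 0 < w.re) :
    mellin (barnesKernel w) s = Complex.Gamma s * barnesSeries ![1, 1] s w := by
  have hs0 : 0 < s.re := by linarith
  have hre : ∀ k : ℕ × ℕ, 0 < (w + k.1 + k.2).re := fun k => by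
    simp only [Complex.add_re, Complex.natCast_re]; positivity
  set F : ℕ × ℕ → ℝ → ℂ := fun k t => (t : ℂ) ^ (s - 1) * Complex.exp (-(w + k.1 + k.2) * t)
  have hFi : ∀ k, Integrable (F k) (volume.restrict (Set.Ioi 0)) := fun k =>
    mellinConvergent_cexp hs0 (hre k)
  have hFn : ∀ k, ∫ t in Set.Ioi (0 : ℝ), ‖F k t‖ =
      (w.re + k.1 + k.2) ^ (-s.re) * Real.Gamma s.re := by
    intro k
    have hr : 0 < w.re + k.1 + k.2 := by simpa using hre k
    have := Real.integral_rpow_mul_exp_neg_mul_Ioi hs0 hr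
    rw [one_div, Real.inv_rpow hr.le, ← Real.rpow_neg hr.le] at this
    rw [← this]
    refine setIntegral_congr_fun measurableSet_Ioi fun t ht => ?_
    have ht : 0 < t := ht
    simp only [F, norm_mul, Complex.norm_exp, Complex.norm_cpow_eq_rpow_re_of_pos ht]
    simp
    left; ring
  have hsn : Summable fun k => ∫ t in Set.Ioi (0 : ℝ), ‖F k t‖ := by
    simp only [hFn]
    exact (summable_barnes_rpow hw hs).mul_right _
  have hpt : ∀ t ∈ Set.Ioi (0 : ℝ), HasSum (fun k => F k t)
      ((t : ℂ) ^ (s - 1) • barnesKernel w t) := fun t ht =>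
    (hasSum_barnesKernel w ht).mul_left _
  have h2 := hasSum_integral_of_summable_integral_norm hFi hsn
  have h3 : ∫ t in Set.Ioi (0 : ℝ), ∑' k, F k t = mellin (barnesKernel w) s :=
    setIntegral_congr_fun measurableSet_Ioi fun t ht => (hpt t ht).tsum_eq
  rw [h3] at h2
  rw [← h2.tsum_eq, barnesSeries_one_one, ← tsum_mul_left]
  refine tsum_congr fun k => ?_
  rw [integral_cpow_mul_cexp_neg_mul_Ioi hs0 (hre k), mul_comm]

/-! ### Analytic continuation of the Barnes double series -/

/-- `(1 - e^{-t})/t` extends analytically to `0` with value `1` (as a `dslope`), so its inverse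
square is analytic there. The `c j` are the Taylor coefficients. -/
theorem exists_taylor_sq_div_one_sub_exp_neg_sq :
    ∃ c : ℕ → ℝ, ∀ n, (fun t : ℝ => t ^ 2 / (1 - Real.exp (-t)) ^ 2 -
      ∑ j ∈ Finset.range n, c j * t ^ j) =O[𝓝[>] 0] fun t => t ^ n := by
  set f : ℝ → ℝ := fun t => 1 - Real.exp (-t) with hf
  have hfa : AnalyticAt ℝ f 0 := by fun_prop
  have hd : HasDerivAt f 1 0 := by
    have := ((hasDerivAt_id (0 : ℝ)).neg.exp).const_sub 1
    simpa using this
  obtain ⟨p, hp⟩ := hfa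
  have hu : AnalyticAt ℝ (dslope f 0) 0 := ⟨_, hp.has_fpower_series_dslope_fslope⟩
  have hu0 : dslope f 0 0 = 1 := by rw [dslope_same, hd.deriv]
  obtain ⟨r, hr⟩ := ((hu.pow 2).inv (by rw [Pi.pow_apply, hu0]; norm_num))
  refine ⟨r.coeff, fun n => ?_⟩
  have h1 := (hr.isBigO_sub_partialSum_pow n).mono (nhdsWithin_le_nhds (s := Set.Ioi 0))
  refine (h1.congr' ?_ ?_)
  · filter_upwards [self_mem_nhdsWithin] with t ht
    have ht : 0 < t := ht
    simp only [zero_add, Pi.inv_apply, Pi.pow_apply, dslope_of_ne _ ht.ne', slope_def_field,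
      FormalMultilinearSeries.partialSum, FormalMultilinearSeries.apply_eq_pow_smul_coeff,
      smul_eq_mul]
    congr 1
    · simp only [hf, sub_zero, neg_zero, Real.exp_zero, sub_self]
      rw [div_pow, inv_div]
    · exact Finset.sum_congr rfl fun j _ => mul_comm _ _
  · filter_upwards [self_mem_nhdsWithin] with t ht
    rw [Real.norm_of_nonneg (le_of_lt ht)]

/-- The remainder of the Taylor-like expansion `t² e^{-wt}/(1-e^{-t})² = ∑ cⱼ tʲ e^{-wt} + ⋯`. -/
def barnesRemainder (c : ℕ → ℝ) (n : ℕ) (w : ℂ) (t : ℝ) : ℂ :=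
  Complex.exp (-w * t) *
    ((t ^ 2 / (1 - Real.exp (-t)) ^ 2 - ∑ j ∈ Finset.range n, c j * t ^ j : ℝ) : ℂ)

section barnesRemainder

variable {c : ℕ → ℝ} (n : ℕ) {w : ℂ}

theorem one_sub_exp_neg_ne_zero {t : ℝ} (ht : 0 < t) : 1 - Real.exp (-t) ≠ 0 := by
  have : Real.exp (-t) < 1 := by simpa using ht
  linarith

theorem continuousOn_barnesRemainder : ContinuousOn (barnesRemainder c n w) (Set.Ioi 0) := by
  unfold barnesRemainder
  refine ContinuousOn.mul (by fun_prop) (Complex.continuous_ofReal.comp_continuousOn ?_)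
  refine ContinuousOn.sub (ContinuousOn.div (by fun_prop) (by fun_prop) fun t ht => ?_)
    (by fun_prop)
  exact pow_ne_zero _ (one_sub_exp_neg_ne_zero ht)

theorem isBigO_atTop_barnesRemainder (hw : 0 < w.re) :
    barnesRemainder c n w =O[atTop] fun t => Real.exp (-(w.re / 2) * t) := by
  have hb : 0 < w.re / 2 := by linarith
  have hpow : ∀ k : ℕ, (fun t : ℝ => t ^ k) =O[atTop] fun t => Real.exp (w.re / 2 * t) := fun k =>
    (isLittleO_pow_exp_pos_mul_atTop k hb).isBigO
  have h1 : (fun t : ℝ => ((1 - Real.exp (-t)) ^ 2)⁻¹) =O[atTop] fun _ => (1 : ℝ) := by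
    refine Tendsto.isBigO_one ℝ (c := ((1 - 0 : ℝ) ^ 2)⁻¹) ?_
    refine Tendsto.inv₀ (Tendsto.pow (Tendsto.const_sub _ ?_) _) (by norm_num)
    exact Real.tendsto_exp_neg_atTop_nhds_zero
  have h2 : (fun t : ℝ => t ^ 2 / (1 - Real.exp (-t)) ^ 2 - ∑ j ∈ Finset.range n, c j * t ^ j)
      =O[atTop] fun t => Real.exp (w.re / 2 * t) := by
    refine Asymptotics.IsBigO.sub ?_ (Asymptotics.IsBigO.fun_sum fun j _ => (hpow j).const_mul_left _)
    simpa [div_eq_mul_inv] using (hpow 2).mul h1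
  have h3 : (fun t : ℝ => Complex.exp (-w * t)) =O[atTop] fun t => Real.exp (-w.re * t) := by
    refine Asymptotics.IsBigO.of_bound 1 (Eventually.of_forall fun t => ?_)
    rw [Complex.norm_exp]; simp
  have h4 := h3.mul ((Asymptotics.isBigO_norm_left (f' := fun t : ℝ => ((t ^ 2 /
    (1 - Real.exp (-t)) ^ 2 - ∑ j ∈ Finset.range n, c j * t ^ j : ℝ) : ℂ))).mp (by
      simpa only [Complex.norm_real] using h2.norm_left))
  refine h4.congr (fun _ => rfl) fun t => ?_
  rw [← Real.exp_add]; ring_nf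

theorem isBigO_zero_barnesRemainder
    (hc : ∀ n, (fun t : ℝ => t ^ 2 / (1 - Real.exp (-t)) ^ 2 -
      ∑ j ∈ Finset.range n, c j * t ^ j) =O[𝓝[>] 0] fun t => t ^ n) :
    barnesRemainder c n w =O[𝓝[>] 0] fun t => t ^ (-(-n : ℝ)) := by
  have h3 : (fun t : ℝ => Complex.exp (-w * t)) =O[𝓝[>] 0] fun _ => (1 : ℝ) := by
    refine (Continuous.tendsto (by fun_prop) 0).isBigO_one ℝ |>.mono nhdsWithin_le_nhds
  have h4 := h3.mul ((Asymptotics.isBigO_norm_left (f' := fun t : ℝ => ((t ^ 2 /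
    (1 - Real.exp (-t)) ^ 2 - ∑ j ∈ Finset.range n, c j * t ^ j : ℝ) : ℂ))).mp (by
      simpa only [Complex.norm_real] using (hc n).norm_left))
  refine h4.congr (fun _ => rfl) fun t => ?_
  simp

end barnesRemainder

/-- The polynomial `(s-1)(s-2) Γ(s-2+j)/Γ(s)`. -/
def gammaRatioPoly (j : ℕ) (s : ℂ) : ℂ := ∏ i ∈ Finset.range j, (s - 2 + i)

/-- The `j`-th Taylor term contributes `Γ(s-2+j)` to the Mellin transform. After multiplication by
`(s-1)(s-2)/Γ(s)` the functional equation leaves a polynomial, so these terms have no poles in the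
continuation. -/
theorem gammaRatioPoly_mul_Gamma {s : ℂ} (hs : 2 < s.re) (j : ℕ) :
    gammaRatioPoly j s * Complex.Gamma s = (s - 1) * (s - 2) * Complex.Gamma (s - 2 + j) := by
  have hne : ∀ j : ℕ, s - 2 + j ≠ 0 := fun j h => by
    have := congrArg Complex.re h
    simp at this
    have : (0 : ℝ) ≤ j := Nat.cast_nonneg j
    linarith
  induction j with
  | zero =>
    have h1 := Complex.Gamma_add_one (s - 2) (by simpa using hne 0)
    have h2 := Complex.Gamma_add_one (s - 2 + 1) (by simpa using hne 1)
    rw [show s - 2 + 1 + 1 = s by ring] at h2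
    simp only [gammaRatioPoly, Finset.range_zero, Finset.prod_empty, Nat.cast_zero, add_zero]
    rw [h2, h1]
    ring
  | succ j ih =>
    have h1 := Complex.Gamma_add_one (s - 2 + j) (hne j)
    rw [gammaRatioPoly, Finset.prod_range_succ, ← gammaRatioPoly, mul_right_comm, ih]
    push_cast
    rw [← add_assoc, h1]
    ring

/-- The continuation of `(s-1)(s-2) ζ₂(s, w)` to `Re s > 2 - n`. -/
def barnesContinuation (c : ℕ → ℝ) (n : ℕ) (w s : ℂ) : ℂ :=
  (s - 1) * (s - 2) * (Complex.Gamma s)⁻¹ * mellin (barnesRemainder c n w) (s - 2) +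
    ∑ j ∈ Finset.range n, c j * gammaRatioPoly j s * w ^ (-(s - 2 + j))

/-- The remainder is `O(t^n)` at `0` and decays exponentially at infinity, so its Mellin transform
at `s-2` is holomorphic for `Re s > 2-n`; `1/Γ` is entire. -/
theorem differentiableAt_barnesContinuation {c : ℕ → ℝ}
    (hc : ∀ n, (fun t : ℝ => t ^ 2 / (1 - Real.exp (-t)) ^ 2 -
      ∑ j ∈ Finset.range n, c j * t ^ j) =O[𝓝[>] 0] fun t => t ^ n)
    (n : ℕ) {w s : ℂ} (hw : 0 < w.re) (hs : 2 - n < s.re) :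
    DifferentiableAt ℂ (barnesContinuation c n w) s := by
  have hw0 : w ≠ 0 := fun h => by simp [h] at hw
  have h1 : DifferentiableAt ℂ (mellin (barnesRemainder c n w)) (s - 2) :=
    mellin_differentiableAt_of_isBigO_rpow_exp (half_pos hw)
      ((continuousOn_barnesRemainder n).locallyIntegrableOn measurableSet_Ioi)
      (isBigO_atTop_barnesRemainder n hw) (isBigO_zero_barnesRemainder n hc) (by simp; linarith)
  have h2 : DifferentiableAt ℂ (fun s => mellin (barnesRemainder c n w) (s - 2)) s :=
    h1.comp s (f := fun s : ℂ => s - 2) (by fun_prop)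
  have h3 : DifferentiableAt ℂ (fun s => (Complex.Gamma s)⁻¹) s :=
    Complex.differentiable_one_div_Gamma s
  unfold barnesContinuation gammaRatioPoly
  refine DifferentiableAt.add (by fun_prop) (DifferentiableAt.fun_sum fun j _ => ?_)
  refine DifferentiableAt.mul (by fun_prop) (DifferentiableAt.const_cpow (by fun_prop) (Or.inl hw0))

theorem barnesContinuation_eq {c : ℕ → ℝ}
    (hc : ∀ n, (fun t : ℝ => t ^ 2 / (1 - Real.exp (-t)) ^ 2 -
      ∑ j ∈ Finset.range n, c j * t ^ j) =O[𝓝[>] 0] fun t => t ^ n)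
    (n : ℕ) {w s : ℂ} (hw : 0 < w.re) (hs : 2 < s.re) :
    barnesContinuation c n w s = (s - 1) * (s - 2) * barnesSeries ![1, 1] s w := by
  have hG : Complex.Gamma s ≠ 0 := Complex.Gamma_ne_zero_of_re_pos (by linarith)
  have hconv : ∀ m, MellinConvergent (barnesRemainder c m w) (s - 2) := fun m =>
    mellinConvergent_of_isBigO_rpow_exp (half_pos hw)
      ((continuousOn_barnesRemainder m).locallyIntegrableOn measurableSet_Ioi)
      (isBigO_atTop_barnesRemainder m hw) (isBigO_zero_barnesRemainder m hc) (by
        have : (0 : ℝ) ≤ m := Nat.cast_nonneg m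
        simp; linarith)
  have hterm : ∀ j : ℕ, MellinConvergent (fun t : ℝ => (t : ℂ) ^ (j : ℂ) • Complex.exp (-w * t))
      (s - 2) ∧ mellin (fun t : ℝ => (t : ℂ) ^ (j : ℂ) • Complex.exp (-w * t)) (s - 2) =
        w ^ (-(s - 2 + j)) * Complex.Gamma (s - 2 + j) := fun j => by
    have hj : 0 < (s - 2 + j).re := by
      have : (0 : ℝ) ≤ j := Nat.cast_nonneg j
      simp; linarith
    rw [MellinConvergent.cpow_smul, mellin_cpow_smul]
    exact ⟨mellinConvergent_cexp hj hw, mellin_cexp hj hw⟩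
  -- Peel off one Taylor term at a time. The factor `e^{-wt}` was left unexpanded, so each term has
  -- an exact Gamma integral.
  have hstep : mellin (barnesRemainder c 0 w) (s - 2) = mellin (barnesRemainder c n w) (s - 2) +
      ∑ j ∈ Finset.range n, c j * (w ^ (-(s - 2 + j)) * Complex.Gamma (s - 2 + j)) := by
    induction n with
    | zero => simp
    | succ n ih =>
      rw [ih, Finset.sum_range_succ]
      have h1 := hasMellin_add (hconv (n + 1)) ((hterm n).1.const_smul (c n : ℂ))
      rw [mellin_const_smul, (hterm n).2] at h1
      have h2 : barnesRemainder c n w = fun t => barnesRemainder c (n + 1) w t +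
          (c n : ℂ) • ((t : ℂ) ^ (n : ℂ) • Complex.exp (-w * t)) := by
        funext t
        simp only [barnesRemainder, Finset.sum_range_succ, smul_eq_mul, Complex.cpow_natCast]
        push_cast
        ring
      rw [h2, h1.2, smul_eq_mul]
      ring
  have hzero : mellin (barnesRemainder c 0 w) (s - 2) =
      Complex.Gamma s * barnesSeries ![1, 1] s w := by
    rw [← mellin_barnesKernel hs hw]
    have : barnesRemainder c 0 w = fun t : ℝ => (t : ℂ) ^ (2 : ℂ) • barnesKernel w t := by
      funext t
      simp only [barnesRemainder, barnesKernel, Finset.range_zero, Finset.sum_empty, sub_zero,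
        smul_eq_mul, Complex.cpow_ofNat]
      push_cast
      ring
    rw [this, mellin_cpow_smul]
    ring_nf
  have h3 : ∀ j ∈ Finset.range n, (c j : ℂ) * gammaRatioPoly j s * w ^ (-(s - 2 + j)) =
      (s - 1) * (s - 2) * (Complex.Gamma s)⁻¹ *
        (c j * (w ^ (-(s - 2 + j)) * Complex.Gamma (s - 2 + j))) := fun j _ => by
    have := gammaRatioPoly_mul_Gamma hs j
    field_simp
    linear_combination (c j : ℂ) * w ^ (-(s - 2 + j)) * this
  rw [barnesContinuation, Finset.sum_congr rfl h3, ← Finset.mul_sum, ← mul_add, ← hstep, hzero]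
  field_simp

/-- Functions on half-planes `Re s > 2 - n` with a common restriction glue to an entire function. -/
theorem exists_entire_of_halfPlanes {F : ℕ → ℂ → ℂ} {g : ℂ → ℂ}
    (hd : ∀ n : ℕ, ∀ s : ℂ, 2 - n < s.re → DifferentiableAt ℂ (F n) s)
    (hF : ∀ n : ℕ, ∀ s : ℂ, 2 < s.re → F n s = g s) :
    ∃ W : ℂ → ℂ, Differentiable ℂ W ∧ ∀ s : ℂ, 2 < s.re → W s = g s := by
  have hEq : ∀ m n : ℕ, m ≤ n → ∀ s : ℂ, 2 - m < s.re → F m s = F n s := by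
    intro m n hmn s hs
    have hmn' : (m : ℝ) ≤ n := by exact_mod_cast hmn
    have hU : IsOpen {z : ℂ | 2 - (m : ℝ) < z.re} := isOpen_lt continuous_const Complex.continuous_re
    have hz : (3 : ℂ) ∈ {z : ℂ | 2 - (m : ℝ) < z.re} := by
      have : (0 : ℝ) ≤ m := Nat.cast_nonneg m
      simp; linarith
    refine AnalyticOnNhd.eqOn_of_preconnected_of_eventuallyEq
      (DifferentiableOn.analyticOnNhd (fun z hz => (hd m z hz).differentiableWithinAt) hU)
      (DifferentiableOn.analyticOnNhd
        (fun z hz => (hd n z (lt_of_le_of_lt (by linarith) hz)).differentiableWithinAt) hU)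
      (convex_halfSpace_re_gt _).isPreconnected hz ?_ hs
    have hV : {s : ℂ | (2 : ℝ) < s.re} ∈ 𝓝 (3 : ℂ) :=
      (isOpen_lt continuous_const Complex.continuous_re).mem_nhds (by norm_num)
    filter_upwards [hV] with z hz
    rw [hF m z hz, hF n z hz]
  -- Any index with `2 - N < Re s` is admissible; the `3` makes this inequality strict.
  set N : ℂ → ℕ := fun s => ⌈3 - s.re⌉₊ with hN
  have hNs : ∀ s, 2 - (N s : ℝ) < s.re := fun s => by
    have := Nat.le_ceil (3 - s.re)
    linarith
  refine ⟨fun s => F (N s) s, fun s => ?_, fun s hs => hF _ _ hs⟩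
  have hev : (fun z => F (N z) z) =ᶠ[𝓝 s] F (N s) := by
    filter_upwards [(isOpen_lt continuous_const Complex.continuous_re).mem_nhds (hNs s)] with z hz
    rcases le_total (N z) (N s) with h | h
    · exact hEq _ _ h z (hNs z)
    · exact (hEq _ _ h z hz).symm
  exact (hd _ s (hNs s)).congr_of_eventuallyEq hev

theorem exists_entire_barnes {w : ℂ} (hw : 0 < w.re) :
    ∃ W : ℂ → ℂ, Differentiable ℂ W ∧
      ∀ s : ℂ, 2 < s.re → W s = (s - 1) * (s - 2) * barnesSeries ![1, 1] s w := by
  obtain ⟨c, hc⟩ := exists_taylor_sq_div_one_sub_exp_neg_sq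
  exact exists_entire_of_halfPlanes
    (fun n s hs => differentiableAt_barnesContinuation hc n hw hs)
    (fun n s hs => barnesContinuation_eq hc n hw hs)

theorem mem_barnesDomain_two {s : ℂ} : s ∈ barnesDomain 2 ↔ s ≠ 1 ∧ s ≠ 2 := by
  constructor
  · intro h
    exact ⟨by simpa using h 1 (by norm_num) (by norm_num),
      by simpa using h 2 (by norm_num) (by norm_num)⟩
  · rintro ⟨h1, h2⟩ m hm hm'
    interval_cases m
    · simpa using h1
    · simpa using h2

/-- The entire function `(s-1)(s-2) ζ₂(s, w)`. -/
theorem exists_entire_barnesZeta {w : ℂ} (hw : 0 < w.re) :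
    ∃ W : ℂ → ℂ, Differentiable ℂ W ∧
      (∀ s : ℂ, 2 < s.re → W s = (s - 1) * (s - 2) * barnesSeries ![1, 1] s w) ∧
      ∀ s : ℂ, s ≠ 1 → s ≠ 2 → barnesZeta ![1, 1] s w = W s / ((s - 1) * (s - 2)) := by
  obtain ⟨W, hWd, hW⟩ := exists_entire_barnes hw
  refine ⟨W, hWd, hW, fun s h1 h2 => ?_⟩
  have hZ : IsBarnesZeta ![1, 1] w fun s => W s / ((s - 1) * (s - 2)) := by
    refine ⟨fun s hs => DifferentiableAt.differentiableWithinAt ?_, fun s hs => ?_⟩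
    · rw [mem_barnesDomain_two] at hs
      have := hWd s
      exact DifferentiableAt.div this (by fun_prop)
        (mul_ne_zero (sub_ne_zero.mpr hs.1) (sub_ne_zero.mpr hs.2))
    · have hs : 2 < s.re := by simpa using hs
      have e1 : s - 1 ≠ 0 := fun h => by
        have := congrArg Complex.re h; simp at this; linarith
      have e2 : s - 2 ≠ 0 := fun h => by
        have := congrArg Complex.re h; simp at this; linarith
      simp only [hW s hs]
      field_simp
  have hex : ∃ Z : ℂ → ℂ, IsBarnesZeta ![1, 1] w Z := ⟨_, hZ⟩
  rw [barnesZeta, dif_pos hex]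
  -- The chosen continuation is identified with the constructed one by uniqueness off the poles.
  exact hex.choose_spec.eqOn hZ (mem_barnesDomain_two.mpr ⟨h1, h2⟩)

/-! ### The Mellin transform of `β_{2,2}(δ)` as the exponential of an integral -/

/-- `e^{-δt} / (1 + e^{-t/2})²`. -/
def betaKernel (δ t : ℝ) : ℝ := Real.exp (-δ * t) / (1 + Real.exp (-t / 2)) ^ 2

/-- `∫₀^∞ (e^{-qt} - 1) e^{-δt} / (1 + e^{-t/2})² dt / t`. -/
def betaExponent (δ : ℝ) (q : ℂ) : ℂ :=
  ∫ t in Set.Ioi (0 : ℝ), (Complex.exp (-q * t) - 1) / t * betaKernel δ t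

theorem betaKernel_pos (δ t : ℝ) : 0 < betaKernel δ t := by
  unfold betaKernel; positivity

theorem betaKernel_le (δ t : ℝ) : betaKernel δ t ≤ Real.exp (-δ * t) := by
  unfold betaKernel
  refine div_le_self (Real.exp_pos _).le ?_
  have := Real.exp_pos (-t / 2)
  nlinarith

@[fun_prop]
theorem continuous_betaKernel (δ : ℝ) : Continuous (betaKernel δ) := by
  unfold betaKernel
  refine Continuous.div (by fun_prop) (by fun_prop) fun t => ?_
  positivity

theorem barnesS_half_half (b₀ : ℝ) (h : ℂ → ℂ) (q : ℂ) :
    barnesS b₀ ![1 / 2, 1 / 2] h q =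
      h (q + b₀) - 2 * h (q + b₀ + 1 / 2) + h (q + b₀ + 1) := by
  have : (Finset.univ : Finset (Finset (Fin 2))) = {∅, {0}, {1}, {0, 1}} := by decide
  rw [barnesS, this, Finset.sum_insert (by decide), Finset.sum_insert (by decide),
    Finset.sum_insert (by decide), Finset.sum_singleton]
  have h2 : (2 : ℂ)⁻¹ + 2⁻¹ = 1 := by norm_num
  simp [h2]
  ring

theorem mellinConvergent_barnesKernel {s w : ℂ} (hs : 2 < s.re) (hw : 0 < w.re) :
    MellinConvergent (barnesKernel w) s := by
  obtain ⟨c, hc⟩ := exists_taylor_sq_div_one_sub_exp_neg_sq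
  have h1 : MellinConvergent (barnesRemainder c 0 w) (s - 2) :=
    mellinConvergent_of_isBigO_rpow_exp (half_pos hw)
      ((continuousOn_barnesRemainder 0).locallyIntegrableOn measurableSet_Ioi)
      (isBigO_atTop_barnesRemainder 0 hw) (isBigO_zero_barnesRemainder 0 hc) (by simp; linarith)
  have : barnesRemainder c 0 w = fun t : ℝ => (t : ℂ) ^ (2 : ℂ) • barnesKernel w t := by
    funext t
    simp only [barnesRemainder, barnesKernel, Finset.range_zero, Finset.sum_empty, sub_zero,
      smul_eq_mul, Complex.cpow_ofNat]
    push_cast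
    ring
  rw [this, MellinConvergent.cpow_smul] at h1
  simpa using h1

/-- With `x = e^{-t/2}` the three shifts give `1 - 2x + x² = (1-x)²`, which cancels against `(1-x²)²
= (1-x)²(1+x)²`. This removes the double pole at `t = 0`. -/
theorem barnesKernel_combination (δ : ℝ) (q : ℂ) {t : ℝ} (ht : 0 < t) :
    barnesKernel (q + δ) t - 2 * barnesKernel (q + δ + 1 / 2) t + barnesKernel (q + δ + 1) t =
      Complex.exp (-q * t) * betaKernel δ t := by
  set x : ℂ := Complex.exp (-t / 2) with hx
  have hx2 : Complex.exp (-t) = x ^ 2 := by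
    rw [hx, ← Complex.exp_nat_mul]; ring_nf
  have hne : 1 - x ^ 2 ≠ 0 := by
    rw [← hx2]
    have := one_sub_exp_neg_ne_zero ht
    exact_mod_cast this
  have h1 : 1 - x ≠ 0 := fun h => hne (by linear_combination (1 + x) * h)
  have h2 : 1 + x ≠ 0 := fun h => hne (by linear_combination (1 - x) * h)
  have e1 : Complex.exp (-(q + δ + 1 / 2) * t) = Complex.exp (-(q + δ) * t) * x := by
    rw [hx, ← Complex.exp_add]; ring_nf
  have e2 : Complex.exp (-(q + δ + 1) * t) = Complex.exp (-(q + δ) * t) * x ^ 2 := by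
    rw [← hx2, ← Complex.exp_add]; ring_nf
  have e3 : ((betaKernel δ t : ℝ) : ℂ) = Complex.exp (-δ * t) / (1 + x) ^ 2 := by
    simp [betaKernel, hx]
  have e4 : Complex.exp (-(q + δ) * t) = Complex.exp (-q * t) * Complex.exp (-δ * t) := by
    rw [← Complex.exp_add]; ring_nf
  simp only [barnesKernel, hx2, e1, e2, e3, e4]
  have h3 : (1 - x ^ 2) ^ 2 = (1 - x) ^ 2 * (1 + x) ^ 2 := by ring
  rw [h3]
  field_simp
  ring

theorem hasMellin_cexp_mul_betaKernel {δ : ℝ} {q s : ℂ} (hq : -δ < q.re) (hs : 2 < s.re) :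
    HasMellin (fun t : ℝ => Complex.exp (-q * t) * betaKernel δ t) s
      (Complex.Gamma s * barnesS δ ![1 / 2, 1 / 2] (barnesSeries ![1, 1] s) q) := by
  have hw1 : 0 < (q + δ).re := by simp; linarith
  have hw2 : 0 < (q + δ + 1 / 2).re := by simp; linarith
  have hw3 : 0 < (q + δ + 1).re := by simp; linarith
  have h := hasMellin_add (hasMellin_sub (mellinConvergent_barnesKernel hs hw1)
      ((mellinConvergent_barnesKernel hs hw2).const_smul (2 : ℂ))).1
      (mellinConvergent_barnesKernel hs hw3)
  have h' := (hasMellin_sub (mellinConvergent_barnesKernel hs hw1)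
      ((mellinConvergent_barnesKernel hs hw2).const_smul (2 : ℂ))).2
  rw [h', mellin_const_smul, mellin_barnesKernel hs hw1, mellin_barnesKernel hs hw2,
    mellin_barnesKernel hs hw3] at h
  have hEq : Set.EqOn (fun t : ℝ => (t : ℂ) ^ (s - 1) • (barnesKernel (q + δ) t -
      (2 : ℂ) • barnesKernel (q + δ + 1 / 2) t + barnesKernel (q + δ + 1) t))
      (fun t : ℝ => (t : ℂ) ^ (s - 1) • (Complex.exp (-q * t) * betaKernel δ t))
      (Set.Ioi 0) := fun t ht => by
    simp only [← barnesKernel_combination δ q ht, smul_eq_mul]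
  constructor
  · exact (integrableOn_congr_fun hEq measurableSet_Ioi).mp h.1
  · rw [mellin, ← setIntegral_congr_fun measurableSet_Ioi hEq, barnesS_half_half]
    refine h.2.trans ?_
    rw [smul_eq_mul]
    ring

theorem norm_cexp_sub_one_mul_le {h : ℝ → ℝ} {δ : ℝ} (hh : ∀ t, 0 ≤ t → |h t| ≤ Real.exp (-δ * t))
    {q : ℂ} {t : ℝ} (ht : 0 ≤ t) :
    ‖(Complex.exp (-q * t) - 1) * h t‖ ≤ 2 * Real.exp (-min δ (q.re + δ) * t) := by
  rw [norm_mul, Complex.norm_real, Real.norm_eq_abs]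
  have h1 : ‖Complex.exp (-q * t) - 1‖ ≤ Real.exp (-q.re * t) + 1 := by
    refine (norm_sub_le _ _).trans ?_
    rw [Complex.norm_exp]; simp
  calc ‖Complex.exp (-q * t) - 1‖ * |h t|
      ≤ (Real.exp (-q.re * t) + 1) * Real.exp (-δ * t) :=
        mul_le_mul h1 (hh t ht) (abs_nonneg _) (by positivity)
    _ = Real.exp (-(q.re + δ) * t) + Real.exp (-δ * t) := by
        rw [add_mul, ← Real.exp_add]; ring_nf
    _ ≤ Real.exp (-min δ (q.re + δ) * t) + Real.exp (-min δ (q.re + δ) * t) := by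
        gcongr
        · exact min_le_right _ _
        · exact min_le_left _ _
    _ = _ := by ring

/-- The factor `e^{-qt} - 1` is `O(t)` at `0`. This moves the edge of convergence to `Re s = -1`, so
that `s = 0`, where the log-gamma function lives, becomes an interior point. -/
theorem mellin_cexp_sub_one_mul {h : ℝ → ℝ} (hc : Continuous h) {δ : ℝ}
    (hh : ∀ t, 0 ≤ t → |h t| ≤ Real.exp (-δ * t)) (hδ : 0 < δ) {q s : ℂ} (hq : -δ < q.re)
    (hs : -1 < s.re) :
    MellinConvergent (fun t : ℝ => (Complex.exp (-q * t) - 1) * h t) s ∧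
      DifferentiableAt ℂ (mellin fun t : ℝ => (Complex.exp (-q * t) - 1) * h t) s := by
  have h0 : LocallyIntegrableOn (fun t : ℝ => (Complex.exp (-q * t) - 1) * h t) (Set.Ioi 0) :=
    (Continuous.continuousOn (by fun_prop)).locallyIntegrableOn measurableSet_Ioi
  have hpos : 0 < min δ (q.re + δ) := lt_min hδ (by linarith)
  have htop : (fun t : ℝ => (Complex.exp (-q * t) - 1) * h t) =O[atTop]
      fun t => Real.exp (-min δ (q.re + δ) * t) := by
    refine Asymptotics.IsBigO.of_bound 2 ?_
    filter_upwards [eventually_ge_atTop 0] with t ht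
    rw [Real.norm_of_nonneg (Real.exp_pos _).le]
    exact norm_cexp_sub_one_mul_le hh ht
  have hbot : (fun t : ℝ => (Complex.exp (-q * t) - 1) * h t) =O[𝓝[>] 0]
      fun t => t ^ (-(-1) : ℝ) := by
    have h1 : (fun t : ℝ => Complex.exp (-q * t) - 1) =O[𝓝 0] fun t : ℝ => t := by
      have h2 : HasDerivAt (fun t : ℝ => Complex.exp (-q * t)) (-q) 0 := by
        have h3 : HasDerivAt (fun t : ℝ => -q * (t : ℂ)) (-q) 0 := by
          simpa using (Complex.ofRealCLM.hasDerivAt (x := (0 : ℝ))).const_mul (-q)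
        simpa using h3.cexp
      simpa using h2.differentiableAt.isBigO_sub
    have h2 : (fun t : ℝ => ((h t : ℝ) : ℂ)) =O[𝓝 0] fun _ => (1 : ℝ) :=
      (Continuous.tendsto (by fun_prop) 0).isBigO_one ℝ
    refine ((h1.mul h2).mono nhdsWithin_le_nhds).congr (fun _ => rfl) fun t => ?_
    simp
  exact ⟨mellinConvergent_of_isBigO_rpow_exp hpos h0 htop hbot hs,
    mellin_differentiableAt_of_isBigO_rpow_exp hpos h0 htop hbot hs⟩

theorem differentiableAt_mellin_betaKernel {δ : ℝ} (hδ : 0 < δ) {q s : ℂ} (hq : -δ < q.re)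
    (hs : -1 < s.re) : DifferentiableAt ℂ
      (mellin fun t : ℝ => (Complex.exp (-q * t) - 1) * betaKernel δ t) s :=
  (mellin_cexp_sub_one_mul (continuous_betaKernel δ) (fun t _ => by
    rw [abs_of_pos (betaKernel_pos _ _)]; exact betaKernel_le δ t) hδ hq hs).2

theorem hasDerivAt_barnesZeta {w : ℂ} (hw : 0 < w.re) :
    HasDerivAt (fun s => barnesZeta ![1, 1] s w) (barnesLogGamma ![1, 1] w) 0 := by
  obtain ⟨W, hWd, -, hW⟩ := exists_entire_barnesZeta hw
  refine DifferentiableAt.hasDerivAt ?_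
  have h1 : DifferentiableAt ℂ (fun s => W s / ((s - 1) * (s - 2))) 0 := by
    have := hWd 0
    exact DifferentiableAt.div this (by fun_prop) (by norm_num)
  refine h1.congr_of_eventuallyEq ?_
  filter_upwards [isOpen_ne.mem_nhds (by norm_num : (0 : ℂ) ≠ 1),
    isOpen_ne.mem_nhds (by norm_num : (0 : ℂ) ≠ 2)] with s h1 h2 using hW s h1 h2

/-- `S₂ζ₂(s) - S₂ζ₂(s)|_{q=0}` is a Mellin transform divided by `Γ(s)`, for `Re s > -1`. -/
theorem barnesS_barnesZeta_sub {δ : ℝ} (hδ : 0 < δ) {q s : ℂ} (hq : -δ < q.re) (hs : -1 < s.re)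
    (h1 : s ≠ 1) (h2 : s ≠ 2) :
    barnesS δ ![1 / 2, 1 / 2] (barnesZeta ![1, 1] s) q -
      barnesS δ ![1 / 2, 1 / 2] (barnesZeta ![1, 1] s) 0 =
      (Complex.Gamma s)⁻¹ * mellin (fun t : ℝ => (Complex.exp (-q * t) - 1) * betaKernel δ t) s := by
  have hex : ∀ w : ℂ, 0 < w.re → _ := fun w hw => exists_entire_barnesZeta hw
  choose! W hWd hWs hWz using hex
  have hq0 : -δ < (0 : ℂ).re := by simpa using hδ
  have hw : ∀ p : ℂ, -δ < p.re →
      0 < (p + δ).re ∧ 0 < (p + δ + 1 / 2).re ∧ 0 < (p + δ + 1).re := fun p hp => by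
    refine ⟨?_, ?_, ?_⟩ <;> simp <;> linarith
  have hU : IsOpen {z : ℂ | -1 < z.re} := isOpen_lt continuous_const Complex.continuous_re
  have hdiff : ∀ p : ℂ, -δ < p.re →
      Differentiable ℂ fun s => barnesS δ ![1 / 2, 1 / 2] (fun w => W w s) p := fun p hp => by
    obtain ⟨a1, a2, a3⟩ := hw p hp
    simp only [barnesS_half_half]
    exact ((hWd _ a1).sub ((hWd _ a2).const_mul 2)).add (hWd _ a3)
  -- After multiplication by `(s-1)(s-2)` both sides are holomorphic on the whole half-plane `Re s >
  -- -1`. They agree near `s = 3`, where the defining series converges.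
  have key : Set.EqOn (fun s => barnesS δ ![1 / 2, 1 / 2] (fun w => W w s) q -
        barnesS δ ![1 / 2, 1 / 2] (fun w => W w s) 0)
      (fun s => (s - 1) * (s - 2) * ((Complex.Gamma s)⁻¹ *
        mellin (fun t : ℝ => (Complex.exp (-q * t) - 1) * betaKernel δ t) s))
      {z : ℂ | -1 < z.re} := by
    refine AnalyticOnNhd.eqOn_of_preconnected_of_eventuallyEq (z₀ := 3)
      (DifferentiableOn.analyticOnNhd ((hdiff q hq).sub (hdiff 0 hq0)).differentiableOn hU)
      (DifferentiableOn.analyticOnNhd (fun z hz => ?_) hU)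
      (convex_halfSpace_re_gt _).isPreconnected (by simp; norm_num) ?_
    · have a1 := differentiableAt_mellin_betaKernel hδ hq hz
      have a2 := Complex.differentiable_one_div_Gamma z
      exact DifferentiableAt.differentiableWithinAt (by fun_prop)
    · have hV : {s : ℂ | (2 : ℝ) < s.re} ∈ 𝓝 (3 : ℂ) :=
        (isOpen_lt continuous_const Complex.continuous_re).mem_nhds (by norm_num)
      filter_upwards [hV] with z hz
      have hz : 2 < z.re := hz
      have hG : Complex.Gamma z ≠ 0 := Complex.Gamma_ne_zero_of_re_pos (by linarith)
      have m1 := hasMellin_cexp_mul_betaKernel hq hz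
      have m0 := hasMellin_cexp_mul_betaKernel hq0 hz
      have m := (hasMellin_sub m1.1 m0.1).2
      rw [m1.2, m0.2] at m
      have e : (fun t : ℝ => (Complex.exp (-q * t) - 1) * (betaKernel δ t : ℂ)) =
          fun t : ℝ => Complex.exp (-q * t) * betaKernel δ t -
            Complex.exp (-0 * t) * betaKernel δ t := by
        funext t; simp [sub_mul]
      rw [e, m]
      obtain ⟨a1, a2, a3⟩ := hw q hq
      obtain ⟨b1, b2, b3⟩ := hw 0 hq0
      simp only [barnesS_half_half, hWs _ a1 z hz, hWs _ a2 z hz, hWs _ a3 z hz, hWs _ b1 z hz,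
        hWs _ b2 z hz, hWs _ b3 z hz]
      field_simp
  have := key hs
  simp only at this
  have e1 : s - 1 ≠ 0 := sub_ne_zero.mpr h1
  have e2 : s - 2 ≠ 0 := sub_ne_zero.mpr h2
  obtain ⟨a1, a2, a3⟩ := hw q hq
  obtain ⟨b1, b2, b3⟩ := hw 0 hq0
  simp only [barnesS_half_half] at this ⊢
  rw [hWz _ a1 s h1 h2, hWz _ a2 s h1 h2, hWz _ a3 s h1 h2, hWz _ b1 s h1 h2, hWz _ b2 s h1 h2,
    hWz _ b3 s h1 h2, ← mul_right_inj' (mul_ne_zero e1 e2), ← this]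
  field_simp

/-- Since `1/Γ(s) = s/Γ(s+1)`, the derivative at `s = 0` of `M(s)/Γ(s)` is `M(0)`, and the Mellin
weight `t^{s-1}` at `s = 0` is the `1/t` of the Lévy-type integral. -/
theorem barnesS_barnesLogGamma_sub {δ : ℝ} (hδ : 0 < δ) {q : ℂ} (hq : -δ < q.re) :
    barnesS δ ![1 / 2, 1 / 2] (barnesLogGamma ![1, 1]) q -
      barnesS δ ![1 / 2, 1 / 2] (barnesLogGamma ![1, 1]) 0 = betaExponent δ q := by
  have hq0 : -δ < (0 : ℂ).re := by simpa using hδ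
  have hd : ∀ p : ℂ, -δ < p.re →
      HasDerivAt (fun s => barnesS δ ![1 / 2, 1 / 2] (barnesZeta ![1, 1] s) p)
        (barnesS δ ![1 / 2, 1 / 2] (barnesLogGamma ![1, 1]) p) 0 := fun p hp => by
    simp only [barnesS_half_half]
    refine ((hasDerivAt_barnesZeta ?_).sub ((hasDerivAt_barnesZeta ?_).const_mul 2)).add
      (hasDerivAt_barnesZeta ?_) <;> simp <;> linarith
  set M := mellin fun t : ℝ => (Complex.exp (-q * t) - 1) * betaKernel δ t with hM
  have hMd : DifferentiableAt ℂ M 0 := differentiableAt_mellin_betaKernel hδ hq (by simp)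
  have hG : DifferentiableAt ℂ (fun s : ℂ => (Complex.Gamma (s + 1))⁻¹) 0 :=
    (Complex.differentiable_one_div_Gamma (0 + 1)).comp 0 (f := fun s : ℂ => s + 1) (by fun_prop)
  have h1 := (hasDerivAt_id (0 : ℂ)).mul (hG.mul hMd).hasDerivAt
  have h2 := (hd q hq).sub (hd 0 hq0)
  have hev : (fun s => barnesS δ ![1 / 2, 1 / 2] (barnesZeta ![1, 1] s) q -
      barnesS δ ![1 / 2, 1 / 2] (barnesZeta ![1, 1] s) 0) =ᶠ[𝓝 0]
      fun s => s * ((Complex.Gamma (s + 1))⁻¹ * M s) := by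
    filter_upwards [isOpen_ne.mem_nhds (by norm_num : (0 : ℂ) ≠ 1),
      isOpen_ne.mem_nhds (by norm_num : (0 : ℂ) ≠ 2),
      (isOpen_lt continuous_const Complex.continuous_re).mem_nhds
        (by simp : (-1 : ℝ) < (0 : ℂ).re)] with s h1 h2 h3
    rw [barnesS_barnesZeta_sub hδ hq h3 h1 h2, Complex.one_div_Gamma_eq_self_mul_one_div_Gamma_add_one,
      mul_assoc]
  have h3 := (h2.congr_of_eventuallyEq hev.symm).unique h1
  rw [h3]
  simp only [Pi.mul_apply, id, zero_add, Complex.Gamma_one, inv_one, one_mul, zero_mul, add_zero,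
    hM, mellin, betaExponent]
  refine setIntegral_congr_fun measurableSet_Ioi fun t _ => ?_
  simp only [zero_sub, Complex.cpow_neg_one, smul_eq_mul]
  ring

theorem barnesEta_eq_exp_betaExponent {δ : ℝ} (hδ : 0 < δ) {q : ℂ} (hq : -δ < q.re) :
    barnesEta ![1, 1] δ ![1 / 2, 1 / 2] q = Complex.exp (betaExponent δ q) := by
  rw [barnesEta, barnesS_barnesLogGamma_sub hδ hq]

/-! ### Lévy exponents -/

theorem integrable_levy {h : ℝ → ℝ} (hc : Continuous h) {δ : ℝ}
    (hh : ∀ t, 0 ≤ t → |h t| ≤ Real.exp (-δ * t)) (hδ : 0 < δ) {q : ℂ} (hq : -δ < q.re) :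
    IntegrableOn (fun t : ℝ => (Complex.exp (-q * t) - 1) / t * h t) (Set.Ioi 0) := by
  refine (integrableOn_congr_fun (fun t _ => ?_) measurableSet_Ioi).mp
    (mellin_cexp_sub_one_mul hc hh hδ (s := 0) hq (by simp)).1
  simp only [zero_sub, Complex.cpow_neg_one, smul_eq_mul]
  ring

/-- Differentiation in `q` cancels the `1/t`. On a ball of radius half the distance to the line `Re
q = -δ` the derivative is dominated by an exponential. -/
theorem hasDerivAt_levy {h : ℝ → ℝ} (hc : Continuous h) {δ : ℝ}
    (hh : ∀ t, 0 ≤ t → |h t| ≤ Real.exp (-δ * t)) (hδ : 0 < δ) {q : ℂ} (hq : -δ < q.re) :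
    HasDerivAt (fun z : ℂ => ∫ t in Set.Ioi (0 : ℝ), (Complex.exp (-z * t) - 1) / t * h t)
      (∫ t in Set.Ioi (0 : ℝ), -(Complex.exp (-q * t) * h t)) q := by
  set ε : ℝ := (q.re + δ) / 2 with hε
  have hε0 : 0 < ε := by rw [hε]; linarith
  have hm : ∀ z : ℂ, AEStronglyMeasurable
      (fun t : ℝ => (Complex.exp (-z * t) - 1) / t * h t) (volume.restrict (Set.Ioi 0)) :=
    fun z => (by fun_prop : Measurable
      fun t : ℝ => (Complex.exp (-z * t) - 1) / t * h t).aestronglyMeasurable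
  refine (hasDerivAt_integral_of_dominated_loc_of_deriv_le
    (bound := fun t => Real.exp (-ε * t))
    (F' := fun (z : ℂ) (t : ℝ) => -(Complex.exp (-z * t) * h t))
    (s := Metric.ball q ε) (Metric.ball_mem_nhds q hε0)
    (Eventually.of_forall hm) (integrable_levy hc hh hδ hq) ?_ ?_ ?_ ?_).2
  · exact (Continuous.aestronglyMeasurable (by fun_prop))
  · filter_upwards [ae_restrict_mem measurableSet_Ioi] with t ht z hz
    have ht : 0 < t := ht
    have h1 : q.re - ε < z.re := by
      have h2 := (Complex.abs_re_le_norm (z - q)).trans_lt (mem_ball_iff_norm.mp hz)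
      rw [Complex.sub_re] at h2
      linarith [(abs_lt.mp h2).1]
    rw [norm_neg, norm_mul, Complex.norm_exp, Complex.norm_real, Real.norm_eq_abs]
    have h3 : (-z * (t : ℂ)).re = -z.re * t := by simp
    rw [h3]
    calc Real.exp (-z.re * t) * |h t| ≤ Real.exp (-z.re * t) * Real.exp (-δ * t) := by
          gcongr; exact hh t ht.le
      _ = Real.exp (-(z.re + δ) * t) := by rw [← Real.exp_add]; ring_nf
      _ ≤ _ := by
          gcongr
          linarith
  · exact integrableOn_exp_mul_Ioi (by linarith) 0
  · filter_upwards [ae_restrict_mem measurableSet_Ioi] with t ht z _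
    have ht0 : (t : ℂ) ≠ 0 := by exact_mod_cast (ne_of_gt ht)
    have h1 : HasDerivAt (fun z : ℂ => -z * t) (-t) z := by
      simpa using ((hasDerivAt_id z).neg.mul_const (t : ℂ))
    have h2 := ((h1.cexp.sub_const 1).div_const (t : ℂ)).mul_const (h t : ℂ)
    refine h2.congr_deriv ?_
    field_simp

/-! ### The factors of `β_{2,2}` -/

/-- `e^{-ct} (1 - e^{-t/2})²`. -/
def betaFactorKernel (c t : ℝ) : ℝ := Real.exp (-c * t) * (1 - Real.exp (-t / 2)) ^ 2

@[fun_prop]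
theorem continuous_betaFactorKernel (c : ℝ) : Continuous (betaFactorKernel c) := by
  unfold betaFactorKernel; fun_prop

theorem betaFactorKernel_nonneg (c t : ℝ) : 0 ≤ betaFactorKernel c t := by
  unfold betaFactorKernel; positivity

theorem abs_betaFactorKernel_le (c : ℝ) {t : ℝ} (ht : 0 ≤ t) :
    |betaFactorKernel c t| ≤ Real.exp (-c * t) := by
  rw [abs_of_nonneg (betaFactorKernel_nonneg c t), betaFactorKernel]
  refine mul_le_of_le_one_right (Real.exp_pos _).le ?_
  have h1 := Real.exp_pos (-t / 2)
  have h2 : Real.exp (-t / 2) ≤ 1 := Real.exp_le_one_iff.mpr (by linarith)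
  nlinarith

/-- The Laplace transform of a factor. -/
def betaFactor (c : ℝ) (q : ℂ) : ℂ :=
  c * (c + 1) / (c + 1 / 2) ^ 2 * ((q + c + 1 / 2) ^ 2 / ((q + c) * (q + c + 1)))

/-- A Frullani integral, handled without a complex logarithm: the quotient of the two sides has
derivative zero on a half-plane and is normalised at `q = 0`. -/
theorem betaFactor_eq_exp {c : ℝ} (hc : 0 < c) {q : ℂ} (hq : -c < q.re) :
    Complex.exp (∫ t in Set.Ioi (0 : ℝ), (Complex.exp (-q * t) - 1) / t * betaFactorKernel c t) =
      betaFactor c q := by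
  set H : ℂ → ℂ := fun z =>
    ∫ t in Set.Ioi (0 : ℝ), (Complex.exp (-z * t) - 1) / t * betaFactorKernel c t with hH
  have hne : ∀ z : ℂ, -c < z.re → z + c ≠ 0 ∧ z + c + 1 / 2 ≠ 0 ∧ z + c + 1 ≠ 0 := by
    intro z hz
    refine ⟨fun h => ?_, fun h => ?_, fun h => ?_⟩ <;>
    · have := congrArg Complex.re h
      simp at this
      linarith
  have hint : ∀ z : ℂ, -c < z.re →
      ∫ t in Set.Ioi (0 : ℝ), -(Complex.exp (-z * t) * betaFactorKernel c t) =
        -(1 / (z + c) - 2 / (z + c + 1 / 2) + 1 / (z + c + 1)) := by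
    intro z hz
    have hb : ∀ b : ℝ, 0 ≤ b → IntegrableOn (fun t : ℝ => Complex.exp (-(z + c + b) * t))
        (Set.Ioi 0) ∧ ∫ t in Set.Ioi (0 : ℝ), Complex.exp (-(z + c + b) * t) = 1 / (z + c + b) := by
      intro b hb
      have hre : (-(z + c + b)).re < 0 := by simp; linarith
      refine ⟨integrableOn_exp_mul_complex_Ioi hre 0, ?_⟩
      rw [integral_exp_mul_complex_Ioi hre, Complex.ofReal_zero, mul_zero, Complex.exp_zero,
        neg_div_neg_eq]
    obtain ⟨i0, v0⟩ := hb 0 le_rfl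
    obtain ⟨i1, v1⟩ := hb (1 / 2) (by norm_num)
    obtain ⟨i2, v2⟩ := hb 1 (by norm_num)
    have e : ∀ t : ℝ, -(Complex.exp (-z * t) * betaFactorKernel c t) =
        -(Complex.exp (-(z + c + (0 : ℝ)) * t) - 2 * Complex.exp (-(z + c + (1 / 2 : ℝ)) * t) +
          Complex.exp (-(z + c + (1 : ℝ)) * t)) := by
      intro t
      have e1 : Complex.exp (-(z + c + (0 : ℝ)) * t) = Complex.exp (-z * t) * Complex.exp (-c * t) := by
        rw [← Complex.exp_add]; push_cast; ring_nf
      have e2 : Complex.exp (-(z + c + (1 / 2 : ℝ)) * t) =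
          Complex.exp (-z * t) * Complex.exp (-c * t) * Complex.exp (-t / 2) := by
        rw [← Complex.exp_add, ← Complex.exp_add]; push_cast; ring_nf
      have e3 : Complex.exp (-(z + c + (1 : ℝ)) * t) =
          Complex.exp (-z * t) * Complex.exp (-c * t) * Complex.exp (-t / 2) ^ 2 := by
        rw [← Complex.exp_nat_mul, ← Complex.exp_add, ← Complex.exp_add]; push_cast; ring_nf
      rw [e1, e2, e3]
      simp only [betaFactorKernel]
      push_cast
      ring
    simp only [e]
    have j1 := integral_sub i0 (i1.const_mul 2)
    have j2 := integral_add (i0.sub (i1.const_mul 2)) i2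
    simp only [Pi.sub_apply] at j2
    rw [integral_neg, j2, j1, integral_const_mul, v0, v1, v2]
    push_cast
    ring
  have hd : ∀ z : ℂ, -c < z.re →
      HasDerivAt H (-(1 / (z + c) - 2 / (z + c + 1 / 2) + 1 / (z + c + 1))) z := fun z hz => by
    rw [← hint z hz]
    exact hasDerivAt_levy (continuous_betaFactorKernel c)
      (fun t ht => abs_betaFactorKernel_le c ht) hc hz
  set Y : ℂ → ℂ := fun z =>
    Complex.exp (H z) * ((z + c) * (z + c + 1) / (z + c + 1 / 2) ^ 2) with hY
  have hYd : ∀ z : ℂ, -c < z.re → HasDerivAt Y 0 z := by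
    intro z hz
    obtain ⟨n0, n1, n2⟩ := hne z hz
    have a0 : HasDerivAt (fun z : ℂ => z + c) 1 z := (hasDerivAt_id z).add_const _
    have a1 : HasDerivAt (fun z : ℂ => z + c + 1 / 2) 1 z := a0.add_const _
    have a2 : HasDerivAt (fun z : ℂ => z + c + 1) 1 z := a0.add_const _
    have := (hd z hz).cexp.mul ((a0.mul a2).div (a1.pow 2) (pow_ne_zero 2 n1))
    refine this.congr_deriv ?_
    have alg : ∀ E A B C : ℂ, A ≠ 0 → B ≠ 0 → C ≠ 0 → B = A + 1 / 2 → C = A + 1 →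
        E * -(1 / A - 2 / B + 1 / C) * (A * C / B ^ 2) +
          E * ((((1 * C + A * 1) * B ^ 2) - A * C * (2 * B ^ (2 - 1) * 1)) / (B ^ 2) ^ 2) = 0 := by
      intro E A B C hA hB hC e1 e2
      field_simp
      rw [e1, e2]
      ring
    simpa using alg (Complex.exp (H z)) _ _ _ n0 n1 n2 rfl rfl
  have hU : IsOpen {z : ℂ | -c < z.re} := isOpen_lt continuous_const Complex.continuous_re
  have hconst : Y q = Y 0 := by
    refine hU.is_const_of_deriv_eq_zero (convex_halfSpace_re_gt _).isPreconnected
      (fun z hz => (hYd z hz).differentiableAt.differentiableWithinAt)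
      (fun z hz => (hYd z hz).deriv) hq (by simpa using hc)
  have hH0 : H 0 = 0 := by simp [hH]
  obtain ⟨n0, n1, n2⟩ := hne q hq
  obtain ⟨m0, m1, m2⟩ := hne 0 (by simpa using hc)
  simp only [hY, hH0, Complex.exp_zero, zero_add, one_mul] at hconst
  rw [zero_add] at m0 m1 m2
  rw [betaFactor]
  have : Complex.exp (H q) = c * (c + 1) / (c + 1 / 2) ^ 2 /
      ((q + c) * (q + c + 1) / (q + c + 1 / 2) ^ 2) := by
    rw [← hconst, mul_div_cancel_right₀]
    exact div_ne_zero (mul_ne_zero n0 n2) (pow_ne_zero 2 n1)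
  rw [this]
  field_simp

/-- The density of the absolutely continuous part of a factor. -/
def betaFactorDensity (c x : ℝ) : ℝ :=
  c * (c + 1) / (c + 1 / 2) ^ 2 / 4 * (Real.exp (-c * x) - Real.exp (-(c + 1) * x))

/-- The law on `[0, ∞)` with Laplace transform `betaFactor c`. -/
def betaFactorLaw (c : ℝ) : Measure ℝ :=
  ENNReal.ofReal (c * (c + 1) / (c + 1 / 2) ^ 2) • Measure.dirac 0 +
    halfLineDensity (betaFactorDensity c)

section betaFactorLaw

variable {c : ℝ}

theorem measurable_betaFactorDensity : Measurable (betaFactorDensity c) := by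
  unfold betaFactorDensity; fun_prop

theorem betaFactorDensity_nonneg (hc : 0 < c) {x : ℝ} (hx : 0 < x) :
    0 ≤ betaFactorDensity c x := by
  unfold betaFactorDensity
  refine mul_nonneg (by positivity) (sub_nonneg.mpr (Real.exp_le_exp.mpr ?_))
  nlinarith

/-- With `A = q + c`, `(A+1/2)²/(A(A+1)) = 1 + (1/4)(1/A - 1/(A+1))`: the `1` is the atom at `0`,
the partial fractions are the difference of exponentials in the density. -/
theorem betaFactorLaw_laplace (hc : 0 < c) {q : ℂ} (hq : -c < q.re) :
    Integrable (fun x : ℝ => Complex.exp (-q * x)) (betaFactorLaw c) ∧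
      ∫ x : ℝ, Complex.exp (-q * x) ∂(betaFactorLaw c) = betaFactor c q := by
  have hre0 : (-(q + c)).re < 0 := by simp; linarith
  have hre1 : (-(q + c + 1)).re < 0 := by simp; linarith
  have i0 := integrableOn_exp_mul_complex_Ioi hre0 0
  have i1 := integrableOn_exp_mul_complex_Ioi hre1 0
  have e : ∀ x : ℝ, betaFactorDensity c x • Complex.exp (-q * x) =
      (c * (c + 1) / (c + 1 / 2) ^ 2 / 4 : ℂ) *
        (Complex.exp (-(q + c) * x) - Complex.exp (-(q + c + 1) * x)) := by
    intro x
    have e1 : Complex.exp (-(q + c) * x) = Complex.exp (-q * x) * Complex.exp (-c * x) := by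
      rw [← Complex.exp_add]; ring_nf
    have e2 : Complex.exp (-(q + c + 1) * x) =
        Complex.exp (-q * x) * Complex.exp (-(c + 1) * x) := by
      rw [← Complex.exp_add]; ring_nf
    rw [e1, e2, Complex.real_smul, betaFactorDensity]
    push_cast
    ring
  have hI : Integrable (fun x : ℝ => Complex.exp (-q * x)) (halfLineDensity (betaFactorDensity c)) := by
    rw [integrable_halfLineDensity_iff measurable_betaFactorDensity
      (fun x hx => betaFactorDensity_nonneg hc hx)]
    simp only [e]
    exact (i0.sub i1).const_mul _
  have hD : Integrable (fun x : ℝ => Complex.exp (-q * x))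
      (ENNReal.ofReal (c * (c + 1) / (c + 1 / 2) ^ 2) • Measure.dirac (0 : ℝ)) :=
    (integrable_dirac (by simp)).smul_measure ENNReal.ofReal_ne_top
  refine ⟨hD.add_measure hI, ?_⟩
  have n0 : q + c ≠ 0 := fun h => by
    have := congrArg Complex.re h; simp at this; linarith
  have n1 : q + c + 1 ≠ 0 := fun h => by
    have := congrArg Complex.re h; simp at this; linarith
  rw [betaFactorLaw, integral_add_measure hD hI, integral_smul_measure, integral_dirac,
    integral_halfLineDensity measurable_betaFactorDensity
      (fun x hx => betaFactorDensity_nonneg hc hx)]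
  simp only [e]
  rw [integral_const_mul, integral_sub i0 i1, integral_exp_mul_complex_Ioi hre0,
    integral_exp_mul_complex_Ioi hre1, ENNReal.toReal_ofReal (by positivity), betaFactor,
    Complex.real_smul]
  have hc' : (c : ℂ) + 1 / 2 ≠ 0 := by
    have : c + 1 / 2 ≠ 0 := by positivity
    intro h; apply this; exact_mod_cast (by push_cast; exact h : ((c + 1 / 2 : ℝ) : ℂ) = 0)
  push_cast
  simp only [mul_zero, Complex.exp_zero, mul_one, neg_div_neg_eq]
  field_simp
  ring

theorem betaFactorLaw_Iio : betaFactorLaw c (Set.Iio 0) = 0 := by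
  rw [betaFactorLaw, Measure.add_apply, Measure.smul_apply,
    measure_mono_null Set.Iio_subset_Iic_self (halfLineDensity_Iic _)]
  simp

theorem isProbabilityMeasure_betaFactorLaw (hc : 0 < c) :
    IsProbabilityMeasure (betaFactorLaw c) := by
  have h := betaFactorLaw_laplace hc (q := 0) (by simpa using hc)
  have hfin : IsFiniteMeasure (betaFactorLaw c) := by
    have := h.1
    simp only [neg_zero, zero_mul, Complex.exp_zero] at this
    exact (integrable_const_iff.mp this).resolve_left one_ne_zero
  constructor
  have h2 := h.2
  have n0 : (c : ℂ) ≠ 0 := by exact_mod_cast hc.ne'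
  have n1 : (c : ℂ) + 1 ≠ 0 := by exact_mod_cast (by positivity : c + 1 ≠ 0)
  have n2 : (c : ℂ) + 1 / 2 ≠ 0 := by
    have : c + 1 / 2 ≠ 0 := by positivity
    intro h; apply this; exact_mod_cast (by push_cast; exact h : ((c + 1 / 2 : ℝ) : ℂ) = 0)
  have h3 : betaFactor c 0 = 1 := by
    have n3 : (c : ℂ) * 2 + 1 ≠ 0 := fun h => n2 (by linear_combination h / 2)
    rw [betaFactor, zero_add]
    field_simp
  rw [h3] at h2
  simp only [neg_zero, zero_mul, Complex.exp_zero, integral_const, Complex.real_smul, mul_one] at h2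
  have h4 : (betaFactorLaw c).real Set.univ = 1 := by exact_mod_cast h2
  rw [measureReal_def] at h4
  exact (ENNReal.toReal_eq_one_iff _).mp h4

end betaFactorLaw

/-! ### Existence of `β_{2,2}(δ)` -/

/-- The parameters `δ + k₁ + k₂` of the factors. -/
def betaParam (δ : ℝ) (n : ℕ) : ℝ := δ + n.unpair.1 + n.unpair.2

theorem le_betaParam (δ : ℝ) (n : ℕ) : δ ≤ betaParam δ n := by
  unfold betaParam
  have h1 : (0 : ℝ) ≤ n.unpair.1 := Nat.cast_nonneg _
  have h2 : (0 : ℝ) ≤ n.unpair.2 := Nat.cast_nonneg _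
  linarith

/-- `betaKernel δ` is `barnesKernel δ` times `(1-e^{-t/2})²`. Expanding the former as a double
geometric series and listing its pairs by `Nat.unpair` splits the Lévy density into those of the
factors. -/
theorem hasSum_betaFactorKernel (δ : ℝ) {t : ℝ} (ht : 0 < t) :
    HasSum (fun n => betaFactorKernel (betaParam δ n) t) (betaKernel δ t) := by
  have h1 := (Nat.pairEquiv.symm.hasSum_iff.mpr (hasSum_barnesKernel δ ht)).mul_right
    ((1 - Complex.exp (-t / 2)) ^ 2)
  rw [← Complex.hasSum_ofReal]
  have e : ((betaKernel δ t : ℝ) : ℂ) = barnesKernel δ t * (1 - Complex.exp (-t / 2)) ^ 2 := by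
    have h2 := barnesKernel_combination δ 0 ht
    have e1 : barnesKernel (0 + δ + 1 / 2) t = barnesKernel δ t * Complex.exp (-t / 2) := by
      rw [barnesKernel, barnesKernel, div_mul_eq_mul_div, ← Complex.exp_add]; ring_nf
    have e2 : barnesKernel (0 + δ + 1) t = barnesKernel δ t * Complex.exp (-t / 2) ^ 2 := by
      rw [barnesKernel, barnesKernel, div_mul_eq_mul_div, ← Complex.exp_nat_mul, ← Complex.exp_add]
      ring_nf
    rw [e1, e2] at h2
    simp only [zero_add, neg_zero, zero_mul, Complex.exp_zero, one_mul] at h2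
    rw [← h2]
    ring
  rw [e]
  refine h1.congr_fun fun n => ?_
  simp only [Function.comp_apply, betaFactorKernel, betaParam, Nat.pairEquiv_symm_apply]
  push_cast
  ring

/-- The factor kernels are nonnegative, so the dominating series sums to the norm of the full
integrand, which is integrable. -/
theorem hasSum_betaExponent {δ : ℝ} (hδ : 0 < δ) {q : ℂ} (hq : -δ < q.re) :
    HasSum (fun n => ∫ t in Set.Ioi (0 : ℝ),
      (Complex.exp (-q * t) - 1) / t * betaFactorKernel (betaParam δ n) t) (betaExponent δ q) := by
  have hI : IntegrableOn (fun t : ℝ => (Complex.exp (-q * t) - 1) / t * betaKernel δ t)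
      (Set.Ioi 0) := integrable_levy (continuous_betaKernel δ) (fun t _ => by
    rw [abs_of_pos (betaKernel_pos _ _)]; exact betaKernel_le δ t) hδ hq
  refine hasSum_integral_of_dominated_convergence
    (fun n t => ‖(Complex.exp (-q * t) - 1) / t‖ * betaFactorKernel (betaParam δ n) t)
    (fun n => ?_) (fun n => ae_of_all _ fun t => ?_) ?_ ?_ ?_
  · exact (by fun_prop : Measurable fun t : ℝ => (Complex.exp (-q * t) - 1) / t *
      betaFactorKernel (betaParam δ n) t).aestronglyMeasurable
  · rw [norm_mul, Complex.norm_real, Real.norm_of_nonneg (betaFactorKernel_nonneg _ _)]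
  · filter_upwards [ae_restrict_mem measurableSet_Ioi] with t ht
    exact (hasSum_betaFactorKernel δ ht).summable.mul_left _
  · refine hI.norm.congr ?_
    filter_upwards [ae_restrict_mem measurableSet_Ioi] with t ht
    rw [((hasSum_betaFactorKernel δ ht).mul_left _).tsum_eq, norm_mul, Complex.norm_real,
      Real.norm_of_nonneg (betaKernel_pos _ _).le]
  · filter_upwards [ae_restrict_mem measurableSet_Ioi] with t ht
    exact (Complex.hasSum_ofReal.mpr (hasSum_betaFactorKernel δ ht)).mul_left _

theorem tendsto_prod_betaFactor {δ : ℝ} (hδ : 0 < δ) {q : ℂ} (hq : -δ < q.re) :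
    Tendsto (fun N => ∏ n ∈ Finset.range N, betaFactor (betaParam δ n) q) atTop
      (𝓝 (Complex.exp (betaExponent δ q))) := by
  refine ((Complex.continuous_exp.tendsto _).comp
    (hasSum_betaExponent hδ hq).tendsto_sum_nat).congr fun N => ?_
  rw [Function.comp_apply, Complex.exp_sum]
  refine Finset.prod_congr rfl fun n _ => ?_
  have := le_betaParam δ n
  exact betaFactor_eq_exp (by linarith) (by linarith)

/-- `β₂,₂(δ)` is realised as `e^{-X}`, where `X` is a sum of independent variables with laws
`betaFactorLaw (betaParam δ n)`. The finite products of Laplace transforms converge to `exp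
(betaExponent δ q)`; being convergent, they are bounded, which is what `exists_law_tsum` needs. -/
theorem exists_isBarnesBeta {δ : ℝ} (hδ : 0 < δ) :
    ∃ μ : Measure ℝ, IsBarnesBeta ![1, 1] δ ![1 / 2, 1 / 2] μ := by
  have hc : ∀ n, 0 < betaParam δ n := fun n => hδ.trans_le (le_betaParam δ n)
  have hprob : ∀ n, IsProbabilityMeasure (betaFactorLaw (betaParam δ n)) := fun n =>
    isProbabilityMeasure_betaFactorLaw (hc n)
  have hcast : ∀ r x : ℝ, Complex.exp (-(-r : ℂ) * x) = (Real.exp (r * x) : ℂ) := fun r x => by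
    push_cast; ring_nf
  have hlap : ∀ n (q : ℂ), -δ < q.re →
      Integrable (fun x : ℝ => Complex.exp (-q * x)) (betaFactorLaw (betaParam δ n)) ∧
      ∫ x : ℝ, Complex.exp (-q * x) ∂(betaFactorLaw (betaParam δ n)) =
        betaFactor (betaParam δ n) q := fun n q hq =>
    betaFactorLaw_laplace (hc n) (by linarith [le_betaParam δ n])
  obtain ⟨ν, h1, h2, -, h4⟩ := exists_law_tsum (fun n => betaFactorLaw (betaParam δ n))
    (fun n => betaFactorLaw_Iio) hδ (fun n r hr => by
      have := (hlap n (-r) (by simpa using hr)).1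
      simp only [hcast] at this
      exact this.re)
    (fun r h0 hr => by
      have hr' : -δ < (-r : ℂ).re := by simpa using hr
      have h5 := (tendsto_prod_betaFactor hδ hr').norm
      obtain ⟨C, hC⟩ := h5.bddAbove_range
      refine ⟨C, fun N => le_trans (le_of_eq ?_) (hC ⟨N, rfl⟩)⟩
      simp only [norm_prod]
      refine Finset.prod_congr rfl fun n _ => ?_
      rw [← (hlap n _ hr').2]
      simp only [hcast, integral_complex_ofReal]
      rw [Complex.norm_real, Real.norm_of_nonneg (integral_nonneg fun x => (Real.exp_pos _).le)])
  have hmeas : Measurable fun x : ℝ => Real.exp (-x) := by fun_prop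
  have hpow : ∀ (q : ℂ) (x : ℝ), ((Real.exp (-x) : ℝ) : ℂ) ^ q = Complex.exp (-q * x) := by
    intro q x
    rw [Complex.cpow_def_of_ne_zero (by exact_mod_cast (Real.exp_pos _).ne'),
      ← Complex.ofReal_log (Real.exp_pos _).le, Real.log_exp]
    push_cast
    ring_nf
  refine ⟨ν.map fun x => Real.exp (-x), ⟨Measure.isProbabilityMeasure_map hmeas.aemeasurable, ?_,
    fun q hq => ?_, fun q hq => ?_⟩⟩
  · rw [Measure.map_apply hmeas measurableSet_Ioc.compl]
    refine measure_mono_null (fun x hx => ?_) h2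
    simp only [Set.mem_preimage, Set.mem_compl_iff, Set.mem_Ioc, not_and, not_le] at hx
    have := hx (Real.exp_pos _)
    rw [Real.one_lt_exp_iff] at this
    exact neg_pos.mp this
  · rw [integrable_map_measure (Measurable.aestronglyMeasurable (by fun_prop)) hmeas.aemeasurable]
    simp only [Function.comp_def, hpow]
    exact (h4 q hq).1
  · rw [integral_map hmeas.aemeasurable (Measurable.aestronglyMeasurable (by fun_prop))]
    simp only [hpow]
    rw [barnesEta_eq_exp_betaExponent hδ hq]
    have h5 := (h4 q hq).2
    simp only [fun n => (hlap n q hq).2] at h5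
    exact tendsto_nhds_unique h5 (tendsto_prod_betaFactor hδ hq)

theorem isBarnesBeta_beta22 {δ : ℝ} (hδ : 0 < δ) :
    IsBarnesBeta ![1, 1] δ ![1 / 2, 1 / 2] (beta22 δ) := by
  rw [beta22, barnesBeta, dif_pos (exists_isBarnesBeta hδ)]
  exact (exists_isBarnesBeta hδ).choose_spec

/-! ### Cumulants -/

theorem logMellinBeta22_eq {δ : ℝ} (hδ : 0 < δ) {q : ℝ} (hq : -δ < q) :
    logMellinBeta22 δ q = (betaExponent δ q).re := by
  have hμ := isBarnesBeta_beta22 hδ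
  have hpos : ∀ᵐ x ∂(beta22 δ), x ∈ Set.Ioc (0 : ℝ) 1 := hμ.support
  have h1 := hμ.mellin q (by simpa using hq)
  rw [barnesEta_eq_exp_betaExponent hδ (by simpa using hq)] at h1
  have h2 : ∫ x : ℝ, (x : ℂ) ^ (q : ℂ) ∂(beta22 δ) = ((∫ x : ℝ, x ^ q ∂(beta22 δ) : ℝ) : ℂ) := by
    rw [← integral_complex_ofReal]
    refine integral_congr_ae ?_
    filter_upwards [hpos] with x hx
    rw [Complex.ofReal_cpow hx.1.le]
  have h3 : betaExponent δ q = ((betaExponent δ q).re : ℂ) := by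
    have : betaExponent δ q = ((∫ t in Set.Ioi (0 : ℝ),
        (Real.exp (-q * t) - 1) / t * betaKernel δ t : ℝ) : ℂ) := by
      rw [betaExponent, ← integral_complex_ofReal]
      refine integral_congr_ae (ae_of_all _ fun t => ?_)
      push_cast
      ring
    rw [this, Complex.ofReal_re]
  rw [h2, h3, ← Complex.ofReal_exp] at h1
  rw [logMellinBeta22, Complex.ofReal_injective h1, Real.log_exp]

theorem integrable_betaKernel_moment {δ : ℝ} (hδ : 0 < δ) (n : ℕ) :
    IntegrableOn (fun t => t ^ n * betaKernel δ t) (Set.Ioi 0) := by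
  have h := integrableOn_rpow_mul_exp_neg_mul_rpow (p := 1) (s := n) (b := δ)
    (by have : (0 : ℝ) ≤ n := Nat.cast_nonneg n
        linarith) (by norm_num) hδ
  refine Integrable.mono' h (Continuous.aestronglyMeasurable (by fun_prop)) ?_
  filter_upwards [ae_restrict_mem measurableSet_Ioi] with t ht
  have ht : 0 < t := ht
  rw [norm_mul, Real.norm_of_nonneg (betaKernel_pos _ _).le, Real.norm_of_nonneg (by positivity)]
  simp only [Real.rpow_natCast, Real.rpow_one]
  gcongr
  exact betaKernel_le δ t

-- The first derivative of the exponent is minus the moment generating function of `-t` under the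
-- measure with density `betaKernel δ`. Each further derivative brings down a factor `-t`, and the
-- sign `(-1)^n` in the cumulant makes the result positive.
open ProbabilityTheory in
theorem contDiffAt_logMellinBeta22 {δ : ℝ} (hδ : 0 < δ) (n : ℕ) :
    ContDiffAt ℝ n (logMellinBeta22 δ) 0 ∧
      (1 ≤ n → cumulantBeta22 n δ = ∫ t in Set.Ioi (0 : ℝ), t ^ (n - 1) * betaKernel δ t) := by
  set ν := halfLineDensity (betaKernel δ) with hν
  have hkm : Measurable (betaKernel δ) := (continuous_betaKernel δ).measurable
  have hk0 : ∀ x, 0 < x → 0 ≤ betaKernel δ x := fun x _ => (betaKernel_pos δ x).le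
  set m : ℝ → ℝ := fun q => -mgf (fun t : ℝ => -t) ν q with hm
  have hset : Set.Ioi (-δ) ⊆ integrableExpSet (fun t : ℝ => -t) ν := by
    intro q hq
    have hq : -δ < q := hq
    rw [integrableExpSet, Set.mem_ofPred_eq, hν, integrable_halfLineDensity_iff hkm hk0]
    refine Integrable.mono' (integrableOn_exp_mul_Ioi (by linarith : -(q + δ) < 0) 0)
      (Continuous.aestronglyMeasurable (by fun_prop)) (ae_of_all _ fun t => ?_)
    rw [norm_smul, Real.norm_of_nonneg (betaKernel_pos _ _).le,
      Real.norm_of_nonneg (Real.exp_pos _).le]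
    calc betaKernel δ t * Real.exp (q * -t) ≤ Real.exp (-δ * t) * Real.exp (q * -t) := by
          gcongr; exact betaKernel_le δ t
      _ = _ := by rw [← Real.exp_add]; ring_nf
  have hint : ∀ q, -δ < q → q ∈ interior (integrableExpSet (fun t : ℝ => -t) ν) := fun q hq =>
    interior_mono hset (by rwa [interior_Ioi])
  have hder : ∀ q : ℝ, -δ < q → HasDerivAt (fun x : ℝ => (betaExponent δ x).re) (m q) q := by
    intro q hq
    have h1 := hasDerivAt_levy (continuous_betaKernel δ) (fun t _ => by
      rw [abs_of_pos (betaKernel_pos _ _)]; exact betaKernel_le δ t) hδ (q := q)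
      (by simpa using hq)
    refine h1.real_of_complex.congr_deriv ?_
    simp only [hm, mgf, hν]
    rw [integral_halfLineDensity hkm hk0]
    have : ∀ t : ℝ, -(Complex.exp (-q * t) * betaKernel δ t) =
        ((-(betaKernel δ t • Real.exp (q * -t)) : ℝ) : ℂ) := fun t => by
      push_cast
      rw [smul_eq_mul, mul_comm]
      push_cast
      ring_nf
    simp only [this, integral_complex_ofReal, Complex.ofReal_re, integral_neg]
  have hev : logMellinBeta22 δ =ᶠ[𝓝 0] fun x : ℝ => (betaExponent δ x).re := by
    filter_upwards [Ioi_mem_nhds (by linarith : -δ < 0)] with q hq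
    exact logMellinBeta22_eq hδ hq
  have hderiv : deriv (logMellinBeta22 δ) =ᶠ[𝓝 0] m := by
    refine hev.deriv.trans ?_
    filter_upwards [Ioi_mem_nhds (by linarith : -δ < 0)] with q hq
    exact (hder q hq).deriv
  have hana : AnalyticAt ℝ m 0 := (analyticAt_mgf (hint 0 (by linarith))).neg
  constructor
  -- Smoothness on the real line is inherited from holomorphy of `betaExponent δ` on `Re z > -δ`.
  · have hU : IsOpen {z : ℂ | -δ < z.re} := isOpen_lt continuous_const Complex.continuous_re
    have hd : DifferentiableOn ℂ (betaExponent δ) {z : ℂ | -δ < z.re} := fun z hz =>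
      (hasDerivAt_levy (continuous_betaKernel δ) (fun t _ => by
        rw [abs_of_pos (betaKernel_pos _ _)]; exact betaKernel_le δ t) hδ
        hz).differentiableAt.differentiableWithinAt
    have h0 : AnalyticAt ℂ (betaExponent δ) ((0 : ℝ) : ℂ) :=
      hd.analyticAt (hU.mem_nhds (by simpa using hδ))
    exact h0.contDiffAt.real_of_complex.congr_of_eventuallyEq hev
  · intro hn
    obtain ⟨k, rfl⟩ := Nat.exists_eq_add_of_le' hn
    rw [cumulantBeta22, iteratedDeriv_succ', hderiv.iteratedDeriv_eq, hm]
    rw [show (fun q => -mgf (fun t : ℝ => -t) ν q) = -mgf (fun t : ℝ => -t) ν from rfl,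
      iteratedDeriv_neg, iteratedDeriv_mgf (hint 0 (by linarith)), hν,
      integral_halfLineDensity hkm hk0, Nat.add_sub_cancel, mul_neg, ← neg_mul,
      ← integral_const_mul]
    refine integral_congr_ae (ae_of_all _ fun t => ?_)
    simp only [zero_mul, Real.exp_zero, mul_one, smul_eq_mul]
    rw [neg_pow t, pow_succ]
    have : ((-1 : ℝ) ^ k) * (-1) ^ k = 1 := by rw [← mul_pow]; norm_num
    linear_combination (betaKernel δ t * t ^ k) * this

/-! ### The series for the cumulants -/

/-- Factoring `1 + e^{-t/2} = 2 e^{-t/4} cosh(t/4)` shows that `1/2` is the centre of symmetry in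
`δ`, hence the expansion in powers of `δ - 1/2`. -/
theorem betaKernel_eq_cosh (δ t : ℝ) :
    betaKernel δ t = Real.exp (-(δ - 1 / 2) * t) * (1 / 4 * (1 / Real.cosh (t / 4)) ^ 2) := by
  have h1 : 1 + Real.exp (-t / 2) = 2 * Real.exp (-t / 4) * Real.cosh (t / 4) := by
    rw [Real.cosh_eq]
    have e1 : Real.exp (-t / 4) * Real.exp (t / 4) = 1 := by rw [← Real.exp_add]; ring_nf; simp
    have e2 : Real.exp (-t / 4) * Real.exp (-(t / 4)) = Real.exp (-t / 2) := by
      rw [← Real.exp_add]; ring_nf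
    linear_combination -e1 - e2
  have h2 : Real.exp (-δ * t) = Real.exp (-(δ - 1 / 2) * t) * Real.exp (-t / 4) ^ 2 := by
    rw [← Real.exp_nat_mul, ← Real.exp_add]; ring_nf
  have h3 := (Real.cosh_pos (t / 4)).ne'
  have h4 := (Real.exp_pos (-t / 4)).ne'
  rw [betaKernel, h1, h2]
  field_simp
  norm_num

theorem integral_pow_mul_one_div_cosh (k : ℕ) :
    ∫ t in Set.Ioi (0 : ℝ), t ^ k * (1 / 4 * (1 / Real.cosh (t / 4)) ^ 2) =
      1 / 4 * 4 ^ (k + 1) * sechMoment (k + 1) := by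
  have h := integral_comp_mul_left_Ioi
    (fun u : ℝ => u ^ ((k : ℝ) + 1 - 1) * (1 / Real.cosh u) ^ 2) 0
    (by norm_num : (0 : ℝ) < 1 / 4)
  rw [mul_zero] at h
  rw [sechMoment, ← mul_right_inj' (by norm_num : (4 : ℝ) ≠ 0)]
  rw [show (1 / 4 : ℝ)⁻¹ = 4 by norm_num, smul_eq_mul] at h
  have e : ∀ t : ℝ, t ^ k * (1 / 4 * (1 / Real.cosh (t / 4)) ^ 2) = 1 / 4 * 4 ^ k *
      ((1 / 4 * t) ^ ((k : ℝ) + 1 - 1) * (1 / Real.cosh (1 / 4 * t)) ^ 2) := by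
    intro t
    have h4 : (4 : ℝ) ^ k * (1 / 4) ^ k = 1 := by rw [← mul_pow]; norm_num
    rw [add_sub_cancel_right, Real.rpow_natCast, mul_pow, one_div_mul_eq_div 4 t]
    linear_combination -(t ^ k * (1 / 4 * (1 / Real.cosh (t / 4)) ^ 2)) * h4
  simp only [e]
  rw [integral_const_mul, h]
  ring

/-- Expand `e^{-(δ-1/2)t}` and integrate termwise. With `ε = |δ-1/2|` the absolute values sum to
`t^k betaKernel (1/2-ε) t`, integrable because `0 < δ < 1` makes `1/2 - ε` positive. -/
theorem hasSum_betaKernel_moment {δ : ℝ} (h0 : 0 < δ) (h1 : δ < 1) (k : ℕ) :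
    HasSum (fun m : ℕ => (-(δ - 1 / 2)) ^ m / (m.factorial : ℝ) *
        (1 / 4 * 4 ^ (m + k + 1) * sechMoment (m + k + 1)))
      (∫ t in Set.Ioi (0 : ℝ), t ^ k * betaKernel δ t) := by
  set ε := |δ - 1 / 2| with hε
  have hε1 : 0 < 1 / 2 - ε := by
    have : |δ - 1 / 2| < 1 / 2 := abs_lt.mpr ⟨by linarith, by linarith⟩
    linarith
  have hexp : ∀ x : ℝ, HasSum (fun m : ℕ => x ^ m / (m.factorial : ℝ)) (Real.exp x) := fun x => by
    rw [Real.exp_eq_exp_ℝ]; exact NormedSpace.expSeries_div_hasSum_exp x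
  have hS : ∀ η t : ℝ, HasSum (fun m : ℕ => (-η) ^ m / (m.factorial : ℝ) *
      (t ^ (m + k) * (1 / 4 * (1 / Real.cosh (t / 4)) ^ 2)))
      (t ^ k * betaKernel (η + 1 / 2) t) := by
    intro η t
    have h := (hexp (-η * t)).mul_right (t ^ k * (1 / 4 * (1 / Real.cosh (t / 4)) ^ 2))
    rw [betaKernel_eq_cosh, add_sub_cancel_right, mul_left_comm]
    refine h.congr_fun fun m => ?_
    rw [mul_pow]
    ring
  have hF := hasSum_integral_of_dominated_convergence (μ := volume.restrict (Set.Ioi (0 : ℝ)))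
    (F := fun (m : ℕ) (t : ℝ) => (-(δ - 1 / 2)) ^ m / (m.factorial : ℝ) *
      (t ^ (m + k) * (1 / 4 * (1 / Real.cosh (t / 4)) ^ 2)))
    (f := fun t => t ^ k * betaKernel δ t)
    (fun m t => (-(-ε)) ^ m / (m.factorial : ℝ) *
      (t ^ (m + k) * (1 / 4 * (1 / Real.cosh (t / 4)) ^ 2)))
    (fun m => Measurable.aestronglyMeasurable (by fun_prop)) (fun m => ?_)
    (ae_of_all _ fun t => (hS (-ε) t).summable) ?_ (ae_of_all _ fun t => ?_)
  · refine hF.congr_fun fun m => ?_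
    rw [integral_const_mul, integral_pow_mul_one_div_cosh]
    push_cast
    ring_nf
  · filter_upwards [ae_restrict_mem measurableSet_Ioi] with t ht
    have ht : 0 < t := ht
    rw [norm_mul, norm_div, norm_pow, norm_neg, Real.norm_eq_abs (δ - 1 / 2), ← hε, neg_neg,
      Real.norm_of_nonneg (Nat.cast_nonneg _), Real.norm_of_nonneg (by positivity)]
  · simp only [(hS (-ε) _).tsum_eq]
    rw [show -ε + 1 / 2 = 1 / 2 - ε by ring]
    exact integrable_betaKernel_moment hε1 k
  · have := hS (δ - 1 / 2) t
    rwa [sub_add_cancel] at this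

/-- The constant `32 = 4² · 2` combines the dilation `t = 4u` with the `2` in `√(2q)`: `32^{k/2} ·
2^{1-k/2} = 2 · 4^k`. -/
theorem rpow_mul_Gamma_mul_moment (k : ℕ) (hk : 0 < k) :
    (32 : ℝ) ^ ((k : ℝ) / 2) * Real.Gamma ((k : ℝ) / 2) * ∫ x : ℝ, x ^ (-((k : ℝ) / 2)) ∂distC2 =
      8 * (1 / 4 * 4 ^ k * sechMoment k) := by
  have hk' : (0 : ℝ) < k := by exact_mod_cast hk
  rw [mul_assoc, (isC2_distC2.negative_moment (half_pos hk')).2, ← mul_assoc,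
    mul_div_cancel₀ _ (two_ne_zero)]
  have h1 : (32 : ℝ) ^ ((k : ℝ) / 2) * 2 ^ (1 - (k : ℝ) / 2) = 2 * 4 ^ k := by
    rw [show (32 : ℝ) = 2 ^ (5 : ℝ) by norm_num, ← Real.rpow_mul (by norm_num),
      ← Real.rpow_add (by norm_num), show (5 : ℝ) * (k / 2) + (1 - k / 2) = 1 + 2 * k by ring,
      Real.rpow_add (by norm_num), Real.rpow_mul (by norm_num), Real.rpow_natCast]
    norm_num
  rw [h1]
  ring

theorem cumulant_series {δ : ℝ} (h0 : 0 < δ) (h1 : δ < 1) {n : ℕ} (hn : 1 ≤ n) :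
    Summable (fun m : ℕ => (-(δ - 1 / 2)) ^ m / (m.factorial : ℝ) *
        (32 : ℝ) ^ (((m : ℝ) + n) / 2) * Real.Gamma (((m : ℝ) + n) / 2) *
        ∫ x : ℝ, x ^ (-(((m : ℝ) + n) / 2)) ∂distC2) ∧
      cumulantBeta22 n δ =
        1 / 8 * ∑' m : ℕ, (-(δ - 1 / 2)) ^ m / (m.factorial : ℝ) *
          (32 : ℝ) ^ (((m : ℝ) + n) / 2) * Real.Gamma (((m : ℝ) + n) / 2) *
          ∫ x : ℝ, x ^ (-(((m : ℝ) + n) / 2)) ∂distC2 := by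
  obtain ⟨k, rfl⟩ := Nat.exists_eq_add_of_le' hn
  have h := (hasSum_betaKernel_moment h0 h1 k).mul_left 8
  have h' : HasSum (fun m : ℕ => (-(δ - 1 / 2)) ^ m / (m.factorial : ℝ) *
        (32 : ℝ) ^ (((m : ℝ) + (k + 1 : ℕ)) / 2) * Real.Gamma (((m : ℝ) + (k + 1 : ℕ)) / 2) *
        ∫ x : ℝ, x ^ (-(((m : ℝ) + (k + 1 : ℕ)) / 2)) ∂distC2)
      (8 * ∫ t in Set.Ioi (0 : ℝ), t ^ k * betaKernel δ t) := by
    refine h.congr_fun fun m => ?_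
    have h2 := rpow_mul_Gamma_mul_moment (m + (k + 1)) (by omega)
    rw [Nat.cast_add m (k + 1)] at h2
    rw [mul_assoc, mul_assoc, ← mul_assoc ((32 : ℝ) ^ _), h2]
    push_cast
    ring_nf
  refine ⟨h'.summable, ?_⟩
  rw [h'.tsum_eq, (contDiffAt_logMellinBeta22 h0 (k + 1)).2 hn, Nat.add_sub_cancel]
  ring

/-! ### The moments of `1 / cosh²` -/

theorem one_div_cosh_sq (u : ℝ) :
    (1 / Real.cosh u) ^ 2 = 4 * Real.exp (-2 * u) / (1 + Real.exp (-2 * u)) ^ 2 := by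
  have h1 : 1 + Real.exp (-2 * u) = 2 * Real.exp (-u) * Real.cosh u := by
    rw [Real.cosh_eq]
    have e1 : Real.exp (-u) * Real.exp u = 1 := by rw [← Real.exp_add]; simp
    have e2 : Real.exp (-u) * Real.exp (-u) = Real.exp (-2 * u) := by
      rw [← Real.exp_add]; ring_nf
    linear_combination -e1 - e2
  have h2 : Real.exp (-2 * u) = Real.exp (-u) ^ 2 := by
    rw [← Real.exp_nat_mul]; ring_nf
  have h3 := (Real.cosh_pos u).ne'
  have h4 := (Real.exp_pos (-u)).ne'
  rw [h1, h2]
  field_simp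
  norm_num

/-- The function is `tanh u - 1`, the antiderivative of `1/cosh²` which vanishes at infinity. -/
theorem hasDerivAt_tanh_sub_one (u : ℝ) :
    HasDerivAt (fun u : ℝ => -2 * Real.exp (-2 * u) / (1 + Real.exp (-2 * u)))
      ((1 / Real.cosh u) ^ 2) u := by
  have hx : HasDerivAt (fun u : ℝ => Real.exp (-2 * u)) (-2 * Real.exp (-2 * u)) u := by
    have h := ((hasDerivAt_id u).const_mul (-2)).exp
    simpa [mul_comm] using h
  have hne : 1 + Real.exp (-2 * u) ≠ 0 := by positivity
  refine ((hx.const_mul (-2)).div (hx.const_add 1) hne).congr_deriv ?_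
  rw [one_div_cosh_sq]
  congr 1
  ring

theorem tendsto_exp_neg_two_mul : Tendsto (fun u : ℝ => Real.exp (-2 * u)) atTop (𝓝 0) := by
  have h := Real.tendsto_exp_neg_atTop_nhds_zero.comp
    (tendsto_id.const_mul_atTop (by norm_num : (0 : ℝ) < 2))
  refine h.congr fun u => ?_
  simp

theorem sechMoment_one : sechMoment 1 = 1 := by
  have h := integral_Ioi_of_hasDerivAt_of_tendsto (a := 0) (m := (0 : ℝ))
    (hasDerivAt_tanh_sub_one 0).continuousAt.continuousWithinAt
    (fun u _ => hasDerivAt_tanh_sub_one u)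
    (by simpa using integrableOn_sechMoment one_pos) (by
      have := (tendsto_exp_neg_two_mul.const_mul (-2)).div (tendsto_exp_neg_two_mul.const_add 1)
        (by norm_num)
      rw [mul_zero, zero_div] at this
      exact this)
  rw [sechMoment]
  simp only [sub_self, Real.rpow_zero, one_mul, h]
  norm_num

/-- Integration by parts gives the antiderivative `u (tanh u - 1) - log(1 + e^{-2u})`, which tends
to `0` at infinity and equals `-log 2` at `0`. -/
theorem sechMoment_two : sechMoment 2 = Real.log 2 := by
  have hd : ∀ u : ℝ, HasDerivAt (fun u : ℝ => u * (-2 * Real.exp (-2 * u) /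
      (1 + Real.exp (-2 * u))) - Real.log (1 + Real.exp (-2 * u)))
      (u * (1 / Real.cosh u) ^ 2) u := by
    intro u
    have hx : HasDerivAt (fun u : ℝ => 1 + Real.exp (-2 * u)) (-2 * Real.exp (-2 * u)) u := by
      have h := (((hasDerivAt_id u).const_mul (-2)).exp).const_add 1
      simpa [mul_comm] using h
    have hne : 1 + Real.exp (-2 * u) ≠ 0 := by positivity
    refine (((hasDerivAt_id u).mul (hasDerivAt_tanh_sub_one u)).sub (hx.log hne)).congr_deriv ?_
    simp
  have hlim : Tendsto (fun u : ℝ => u * (-2 * Real.exp (-2 * u) /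
      (1 + Real.exp (-2 * u))) - Real.log (1 + Real.exp (-2 * u))) atTop (𝓝 0) := by
    have h1 : Tendsto (fun u : ℝ => 1 + Real.exp (-2 * u)) atTop (𝓝 1) := by
      simpa using tendsto_exp_neg_two_mul.const_add 1
    have h2 : Tendsto (fun u : ℝ => u * Real.exp (-2 * u)) atTop (𝓝 0) := by
      have h := ((Real.tendsto_pow_mul_exp_neg_atTop_nhds_zero 1).comp
        (tendsto_id.const_mul_atTop (by norm_num : (0 : ℝ) < 2))).const_mul (1 / 2)
      rw [mul_zero] at h
      refine h.congr fun u => ?_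
      simp
      ring
    have h3 := ((h2.const_mul (-2)).div h1 one_ne_zero).sub (h1.log one_ne_zero)
    rw [Real.log_one, mul_zero, zero_div, sub_zero] at h3
    refine h3.congr fun u => ?_
    simp only [Pi.div_apply]
    ring
  have hi : IntegrableOn (fun u : ℝ => u * (1 / Real.cosh u) ^ 2) (Set.Ioi 0) := by
    have := integrableOn_sechMoment two_pos
    norm_num at this
    simpa using this
  have h := integral_Ioi_of_hasDerivAt_of_tendsto (a := 0)
    (hd 0).continuousAt.continuousWithinAt (fun u _ => hd u) hi hlim
  have e : sechMoment 2 = ∫ u in Set.Ioi (0 : ℝ), u * (1 / Real.cosh u) ^ 2 := by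
    rw [sechMoment]; norm_num
  rw [e, h]
  norm_num

/-- The even-indexed terms sum to `2^{-s} ζ(s)`; subtracting them twice flips their sign. The index
`k = 0` contributes `0`, since `1 / 0 ^ s = 0` here. -/
theorem hasSum_alternating_zeta {s : ℕ} (hs : 2 ≤ s) :
    HasSum (fun k : ℕ => -(-1 : ℝ) ^ k * (1 / (k : ℝ) ^ s))
      ((1 - 2 ^ (1 - (s : ℝ))) * ∑' k : ℕ, 1 / (k : ℝ) ^ s) := by
  have h : HasSum (fun k : ℕ => 1 / (k : ℝ) ^ s) (∑' k : ℕ, 1 / (k : ℝ) ^ s) :=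
    (Real.summable_one_div_nat_pow.mpr (by omega)).hasSum
  set Z := ∑' k : ℕ, 1 / (k : ℝ) ^ s
  have he : HasSum (fun k : ℕ => 1 / ((2 * k : ℕ) : ℝ) ^ s) ((1 / 2 ^ s) * Z) := by
    refine (h.mul_left (1 / 2 ^ s)).congr_fun fun k => ?_
    push_cast
    rw [mul_pow, one_div_mul_one_div]
  have ho : HasSum (fun k : ℕ => 1 / ((2 * k + 1 : ℕ) : ℝ) ^ s) (Z - (1 / 2 ^ s) * Z) := by
    have hsum : Summable fun k : ℕ => 1 / ((2 * k + 1 : ℕ) : ℝ) ^ s :=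
      h.summable.comp_injective (i := fun k : ℕ => 2 * k + 1) fun a b hab => by
        simp only at hab; omega
    have h2 := HasSum.even_add_odd (f := fun k : ℕ => 1 / (k : ℝ) ^ s) he hsum.hasSum
    have h3 := h2.unique h
    rw [show Z - 1 / 2 ^ s * Z = ∑' k : ℕ, 1 / ((2 * k + 1 : ℕ) : ℝ) ^ s by linarith]
    exact hsum.hasSum
  have hlast := HasSum.even_add_odd (f := fun k : ℕ => -(-1 : ℝ) ^ k * (1 / (k : ℝ) ^ s))
    (m := -((1 / 2 ^ s) * Z)) (m' := Z - (1 / 2 ^ s) * Z) (by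
      refine he.neg.congr_fun fun k => ?_
      simp [pow_mul]) (by
      refine ho.congr_fun fun k => ?_
      simp [pow_add, pow_mul])
  convert hlast using 1
  rw [Real.rpow_sub (by norm_num), Real.rpow_one, Real.rpow_natCast]
  ring

theorem integral_pow_mul_exp_neg_two_mul {k n : ℕ} (hk : 0 < k) :
    IntegrableOn (fun u : ℝ => u ^ n * Real.exp (-2 * u) ^ k) (Set.Ioi 0) ∧
      ∫ u in Set.Ioi (0 : ℝ), u ^ n * Real.exp (-2 * u) ^ k =
        n.factorial / (2 * (k : ℝ)) ^ (n + 1) := by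
  have hk' : (0 : ℝ) < 2 * k := by positivity
  have hn : (0 : ℝ) ≤ n := Nat.cast_nonneg n
  have e : ∀ u : ℝ, u ^ n * Real.exp (-2 * u) ^ k =
      u ^ ((n : ℝ) + 1 - 1) * Real.exp (-(2 * k * u)) := fun u => by
    rw [add_sub_cancel_right, Real.rpow_natCast, ← Real.exp_nat_mul]; ring_nf
  simp only [e]
  constructor
  · have := integrableOn_rpow_mul_exp_neg_mul_rpow (p := 1) (s := (n : ℝ) + 1 - 1) (b := 2 * k)
      (by linarith) (by norm_num) hk'
    simpa [neg_mul] using this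
  · rw [Real.integral_rpow_mul_exp_neg_mul_Ioi (by linarith) hk', Real.Gamma_nat_eq_factorial,
      ← Nat.cast_add_one, Real.rpow_natCast, one_div_pow]
    ring

/-- With `x = e^{-2u}`, `1/cosh² u = 4x/(1+x)² = -4 ∑ k (-x)^k`. Integrating against `u^s` gives
terms of size `k^{-s}`; the exchange is justified by absolute summability, which requires `s ≥ 2`.
-/
theorem sechMoment_of_two_le {s : ℕ} (hs : 2 ≤ s) :
    sechMoment (s + 1) = 4 * s.factorial / 2 ^ (s + 1) *
      ((1 - 2 ^ (1 - (s : ℝ))) * ∑' k : ℕ, 1 / (k : ℝ) ^ s) := by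
  set F : ℕ → ℝ → ℝ := fun k u => -4 * (-1) ^ k * k * (u ^ s * Real.exp (-2 * u) ^ k) with hF
  have hFi : ∀ k, Integrable (F k) (volume.restrict (Set.Ioi 0)) := fun k => by
    rcases Nat.eq_zero_or_pos k with rfl | hk
    · simp [hF]
    · exact (integral_pow_mul_exp_neg_two_mul hk).1.const_mul _
  have hval : ∀ k : ℕ, (k : ℝ) * ∫ u in Set.Ioi (0 : ℝ), u ^ s * Real.exp (-2 * u) ^ k =
      s.factorial / 2 ^ (s + 1) * (1 / (k : ℝ) ^ s) := fun k => by
    rcases Nat.eq_zero_or_pos k with rfl | hk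
    · have : s ≠ 0 := by omega
      simp [this]
    · rw [(integral_pow_mul_exp_neg_two_mul hk).2]
      have : (k : ℝ) ≠ 0 := by exact_mod_cast hk.ne'
      rw [mul_pow, pow_succ (k : ℝ)]
      field_simp
  have hFn : ∀ k, ∫ u in Set.Ioi (0 : ℝ), ‖F k u‖ =
      4 * (s.factorial / 2 ^ (s + 1)) * (1 / (k : ℝ) ^ s) := fun k => by
    have : ∀ u ∈ Set.Ioi (0 : ℝ), ‖F k u‖ = 4 * k * (u ^ s * Real.exp (-2 * u) ^ k) := by
      intro u hu
      have hu : 0 < u := hu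
      have h1 : 0 ≤ u ^ s * Real.exp (-2 * u) ^ k := by positivity
      simp only [hF, norm_mul, norm_pow, norm_neg, norm_one, one_pow, mul_one, Real.norm_natCast]
      rw [← norm_pow, ← norm_pow, ← norm_mul, Real.norm_of_nonneg h1]
      norm_num
    rw [setIntegral_congr_fun measurableSet_Ioi this, integral_const_mul, mul_assoc, hval]
    ring
  have hsum : Summable fun k => ∫ u in Set.Ioi (0 : ℝ), ‖F k u‖ := by
    simp only [hFn]
    exact (Real.summable_one_div_nat_pow.mpr (by omega)).mul_left _
  have h1 := hasSum_integral_of_summable_integral_norm hFi hsum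
  have h2 : ∫ u in Set.Ioi (0 : ℝ), ∑' k, F k u = sechMoment (s + 1) := by
    refine setIntegral_congr_fun measurableSet_Ioi fun u hu => ?_
    have hu : 0 < u := hu
    have hlt : ‖-Real.exp (-2 * u)‖ < 1 := by
      rw [norm_neg, Real.norm_of_nonneg (Real.exp_pos _).le, Real.exp_lt_one_iff]
      linarith
    have h3 := (hasSum_coe_mul_geometric_of_norm_lt_one hlt).mul_left (-4 * u ^ s)
    rw [add_sub_cancel_right, Real.rpow_natCast, one_div_cosh_sq]
    have h4 : HasSum (fun k => F k u) (-4 * u ^ s * (-Real.exp (-2 * u) /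
        (1 - -Real.exp (-2 * u)) ^ 2)) := by
      refine h3.congr_fun fun k => ?_
      simp only [hF]
      rw [neg_pow (Real.exp _)]
      ring
    rw [h4.tsum_eq, sub_neg_eq_add]
    ring
  rw [h2] at h1
  have h3 := (hasSum_alternating_zeta hs).mul_left (4 * (s.factorial : ℝ) / 2 ^ (s + 1))
  refine h1.unique (h3.congr_fun fun k => ?_)
  simp only [hF]
  rw [integral_const_mul, mul_assoc, hval]
  ring

/-! ### The cumulants at `δ = 1/2` -/

theorem cumulantBeta22_half {n : ℕ} (hn : 1 ≤ n) :
    cumulantBeta22 n (1 / 2) = 1 / 4 * 4 ^ n * sechMoment n := by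
  obtain ⟨k, rfl⟩ := Nat.exists_eq_add_of_le' hn
  rw [(contDiffAt_logMellinBeta22 (by norm_num) (k + 1)).2 hn, Nat.add_sub_cancel]
  simp only [betaKernel_eq_cosh, sub_self, neg_zero, zero_mul, Real.exp_zero, one_mul]
  rw [integral_pow_mul_one_div_cosh]
  push_cast
  rfl

theorem riemannXi_natCast {s : ℕ} (hs : 2 ≤ s) :
    riemannXi s = ((1 / 2 * s * (s - 1) * Real.pi ^ (-(s : ℝ) / 2) * Real.Gamma ((s : ℝ) / 2) *
      ∑' k : ℕ, 1 / (k : ℝ) ^ s : ℝ) : ℂ) := by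
  have hs0 : (0 : ℝ) < s := by exact_mod_cast (by omega : 0 < s)
  rw [riemannXi_eq (by exact_mod_cast (by omega : s ≠ 1)), zeta_nat_eq_tsum_of_gt_one (by omega)]
  · have e1 : ((Real.pi ^ (-(s : ℝ) / 2) : ℝ) : ℂ) = (Real.pi : ℂ) ^ (-(s : ℂ) / 2) := by
      rw [Complex.ofReal_cpow Real.pi_pos.le]; push_cast; rfl
    have e2 : ((Real.Gamma ((s : ℝ) / 2) : ℝ) : ℂ) = Complex.Gamma ((s : ℂ) / 2) := by
      rw [← Complex.Gamma_ofReal]; push_cast; rfl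
    push_cast
    rw [← e1, ← e2]
  · intro m h
    have h2 := congrArg Complex.re h
    have h3 : (s : ℝ) / 2 = -m := by
      have e : ((s : ℂ) / 2) = (((s : ℝ) / 2 : ℝ) : ℂ) := by push_cast; rfl
      rw [e, Complex.ofReal_re] at h2
      simpa using h2
    have : (0 : ℝ) ≤ m := Nat.cast_nonneg m
    linarith

/-- Legendre duplication merges `Γ(s/2) Γ((s+1)/2)` into `2^{1-s} √π Γ(s)`, and `s Γ(s) = s!`. The
factor `(s-1)/2` of `ξ` cancels the denominator `1 - n/2` with `n = s+1`; the rest is bookkeeping of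
powers of `2` and `π`. -/
theorem sechMoment_xi_constant {s : ℕ} (hs : 2 ≤ s) (Z : ℝ) :
    1 / 4 * 4 ^ (s + 1) * (4 * s.factorial / 2 ^ (s + 1) * ((1 - 2 ^ (1 - (s : ℝ))) * Z)) =
      (32 : ℝ) ^ (((s : ℝ) + 1) / 2) / 8 * Real.Gamma (((s : ℝ) + 1) / 2) *
        (((2 : ℝ) ^ (2 - ((s : ℝ) + 1)) - 1) / (1 - ((s : ℝ) + 1) / 2)) *
        (2 / Real.pi) ^ (1 - ((s : ℝ) + 1) / 2) *
        (1 / 2 * s * (s - 1) * Real.pi ^ (-(s : ℝ) / 2) * Real.Gamma ((s : ℝ) / 2) * Z) := by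
  have hs2 : (2 : ℝ) ≤ s := by exact_mod_cast hs
  have hpi := Real.pi_pos
  have hdup := Real.Gamma_mul_Gamma_add_half ((s : ℝ) / 2)
  rw [show (s : ℝ) / 2 + 1 / 2 = ((s : ℝ) + 1) / 2 by ring,
    show 2 * ((s : ℝ) / 2) = s by ring] at hdup
  have hfac : (s.factorial : ℝ) = s * Real.Gamma s := by
    rw [← Real.Gamma_nat_eq_factorial, Real.Gamma_add_one (by linarith)]
  have hq : ((2 : ℝ) ^ (2 - ((s : ℝ) + 1)) - 1) / (1 - ((s : ℝ) + 1) / 2) * (1 / 2 * (s - 1)) =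
      1 - 2 ^ (1 - (s : ℝ)) := by
    rw [show 2 - ((s : ℝ) + 1) = 1 - s by ring, show 1 - ((s : ℝ) + 1) / 2 = (1 - s) / 2 by ring]
    have : (1 : ℝ) - s ≠ 0 := by linarith
    field_simp
    ring
  have hpow : (32 : ℝ) ^ (((s : ℝ) + 1) / 2) / 8 * (2 / Real.pi) ^ (1 - ((s : ℝ) + 1) / 2) *
      Real.pi ^ (-(s : ℝ) / 2) * (2 ^ (1 - (s : ℝ)) * Real.sqrt Real.pi) = 2 ^ (s + 1) := by
    rw [Real.div_rpow (by norm_num) hpi.le, Real.sqrt_eq_rpow,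
      show (32 : ℝ) = 2 ^ (5 : ℝ) by norm_num, ← Real.rpow_mul (by norm_num)]
    have e1 : (2 : ℝ) ^ (5 * (((s : ℝ) + 1) / 2)) / 8 * 2 ^ (1 - ((s : ℝ) + 1) / 2) *
        2 ^ (1 - (s : ℝ)) = 2 ^ (s + 1) := by
      rw [show (8 : ℝ) = 2 ^ (3 : ℝ) by norm_num, ← Real.rpow_sub (by norm_num),
        ← Real.rpow_add (by norm_num), ← Real.rpow_add (by norm_num), ← Real.rpow_natCast]
      push_cast
      ring_nf
    have e2 : Real.pi ^ (-(s : ℝ) / 2) * Real.pi ^ (1 / 2 : ℝ) =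
        Real.pi ^ (1 - ((s : ℝ) + 1) / 2) := by
      rw [← Real.rpow_add hpi]; ring_nf
    have hne : Real.pi ^ (1 - ((s : ℝ) + 1) / 2) ≠ 0 := (Real.rpow_pos_of_pos hpi _).ne'
    have e3 : ∀ A B D P Q R : ℝ, A / 8 * (B / P) * Q * (D * R) = A / 8 * B * D * (Q * R / P) :=
      fun A B D P Q R => by ring
    rw [e3, e1, e2, div_self hne, mul_one]
  have h4 : (4 : ℝ) ^ (s + 1) = 2 ^ (s + 1) * 2 ^ (s + 1) := by
    rw [← mul_pow]; norm_num
  have hrhs : (32 : ℝ) ^ (((s : ℝ) + 1) / 2) / 8 * Real.Gamma (((s : ℝ) + 1) / 2) *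
        (((2 : ℝ) ^ (2 - ((s : ℝ) + 1)) - 1) / (1 - ((s : ℝ) + 1) / 2)) *
        (2 / Real.pi) ^ (1 - ((s : ℝ) + 1) / 2) *
        (1 / 2 * s * (s - 1) * Real.pi ^ (-(s : ℝ) / 2) * Real.Gamma ((s : ℝ) / 2) * Z) =
      ((32 : ℝ) ^ (((s : ℝ) + 1) / 2) / 8 * (2 / Real.pi) ^ (1 - ((s : ℝ) + 1) / 2) *
        Real.pi ^ (-(s : ℝ) / 2)) * (Real.Gamma ((s : ℝ) / 2) * Real.Gamma (((s : ℝ) + 1) / 2)) *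
        (((2 : ℝ) ^ (2 - ((s : ℝ) + 1)) - 1) / (1 - ((s : ℝ) + 1) / 2) * (1 / 2 * (s - 1))) *
        s * Z := by ring
  rw [hrhs, hq, hdup, hfac, h4]
  have h2 : (2 : ℝ) ^ (s + 1) ≠ 0 := by positivity
  rw [show (32 : ℝ) ^ (((s : ℝ) + 1) / 2) / 8 * (2 / Real.pi) ^ (1 - ((s : ℝ) + 1) / 2) *
        Real.pi ^ (-(s : ℝ) / 2) * (Real.Gamma s * 2 ^ (1 - (s : ℝ)) * Real.sqrt Real.pi) =
      Real.Gamma s * ((32 : ℝ) ^ (((s : ℝ) + 1) / 2) / 8 *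
        (2 / Real.pi) ^ (1 - ((s : ℝ) + 1) / 2) * Real.pi ^ (-(s : ℝ) / 2) *
        (2 ^ (1 - (s : ℝ)) * Real.sqrt Real.pi)) by ring, hpow]
  field_simp

theorem cumulantBeta22_half_eq_xi {n : ℕ} (hn : 1 ≤ n) :
    (cumulantBeta22 n (1 / 2) : ℂ) =
      (((32 : ℝ) ^ ((n : ℝ) / 2) / 8 * Real.Gamma ((n : ℝ) / 2) * xiQuotient n *
        (2 / Real.pi) ^ (1 - (n : ℝ) / 2) : ℝ) : ℂ) * riemannXi ((n : ℂ) - 1) := by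
  rw [cumulantBeta22_half hn]
  have hhalf : (1 / 2 : ℂ) = ((1 / 2 : ℝ) : ℂ) := by push_cast; rfl
  -- For `n = 1, 2` the argument `n-1` is `0` or `1`, outside the range of the zeta series; there `ξ
  -- = 1/2` and the moments are `1` and `log 2`.
  obtain rfl | rfl | h3 : n = 1 ∨ n = 2 ∨ 3 ≤ n := by omega
  · have hxi : riemannXi (((1 : ℕ) : ℂ) - 1) = 1 / 2 := by simp [riemannXi]
    rw [hxi, hhalf, ← Complex.ofReal_mul, Complex.ofReal_inj, Nat.cast_one, sechMoment_one,
      Real.Gamma_one_half_eq, xiQuotient, if_neg (by norm_num)]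
    have h : (32 : ℝ) ^ (1 / 2 : ℝ) * Real.sqrt Real.pi * (2 / Real.pi) ^ (1 - 1 / 2 : ℝ) = 8 := by
      rw [show (1 : ℝ) - 1 / 2 = 1 / 2 by norm_num, ← Real.sqrt_eq_rpow, ← Real.sqrt_eq_rpow,
        ← Real.sqrt_mul (by norm_num), ← Real.sqrt_mul (by positivity),
        show (32 : ℝ) * Real.pi * (2 / Real.pi) = 8 ^ 2 by
          have := Real.pi_pos.ne'
          field_simp; norm_num]
      exact Real.sqrt_sq (by norm_num)
    rw [show (2 : ℝ) - 1 = 1 by norm_num, Real.rpow_one]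
    linear_combination (-1 / 8 : ℝ) * h
  · have hxi : riemannXi (((2 : ℕ) : ℂ) - 1) = 1 / 2 := by
      simp only [riemannXi]; norm_num
    rw [hxi, hhalf, ← Complex.ofReal_mul, Complex.ofReal_inj, Nat.cast_ofNat, sechMoment_two,
      xiQuotient, if_pos rfl]
    norm_num
    ring
  · obtain ⟨s, rfl⟩ := Nat.exists_eq_add_of_le' hn
    have hs : 2 ≤ s := by omega
    have hne : ((s + 1 : ℕ) : ℝ) ≠ 2 := by exact_mod_cast (by omega : s + 1 ≠ 2)
    rw [xiQuotient, if_neg hne, show (((s + 1 : ℕ) : ℂ) - 1) = s by push_cast; ring,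
      riemannXi_natCast hs, ← Complex.ofReal_mul, Complex.ofReal_inj, Nat.cast_add_one,
      sechMoment_of_two_le hs]
    exact sechMoment_xi_constant hs _

end

/-! ### The main theorem -/

theorem mainTheorem12 :
    (∀ δ : ℝ, 0 < δ → δ < 1 → ∀ n : ℕ, 1 ≤ n →
      ContDiffAt ℝ n (logMellinBeta22 δ) 0 ∧
      (∀ m : ℕ, Integrable (fun x : ℝ => x ^ (-(((m : ℝ) + n) / 2))) distC2) ∧
      Summable (fun m : ℕ => (-(δ - 1 / 2)) ^ m / (m.factorial : ℝ) *
        (32 : ℝ) ^ (((m : ℝ) + n) / 2) * Real.Gamma (((m : ℝ) + n) / 2) *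
        ∫ x : ℝ, x ^ (-(((m : ℝ) + n) / 2)) ∂distC2) ∧
      cumulantBeta22 n δ =
        1 / 8 * ∑' m : ℕ, (-(δ - 1 / 2)) ^ m / (m.factorial : ℝ) *
          (32 : ℝ) ^ (((m : ℝ) + n) / 2) * Real.Gamma (((m : ℝ) + n) / 2) *
          ∫ x : ℝ, x ^ (-(((m : ℝ) + n) / 2)) ∂distC2) ∧
    (∀ n : ℕ, 1 ≤ n →
      (cumulantBeta22 n (1 / 2) : ℂ) =
        (((32 : ℝ) ^ ((n : ℝ) / 2) / 8 * Real.Gamma ((n : ℝ) / 2) * xiQuotient n *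
          (2 / Real.pi) ^ (1 - (n : ℝ) / 2) : ℝ) : ℂ) * riemannXi ((n : ℂ) - 1)) := by
  refine ⟨fun δ h0 h1 n hn => ⟨(contDiffAt_logMellinBeta22 h0 n).1, fun m => ?_,
    cumulant_series h0 h1 hn⟩, fun n hn => cumulantBeta22_half_eq_xi hn⟩
  refine (isC2_distC2.negative_moment ?_).1
  have : (1 : ℝ) ≤ n := by exact_mod_cast hn
  positivity
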